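/- For $a\in\mathbb{R}$ let $L^1(w_a)$ be the space of real functions on $\mathbb{R}$ with $\|f\|_{L^1(w_a)}=\int_{\mathbb{R}}|f(x)|(1+|x|)^a\,dx<\infty$, and let $$\mathbb{Y}_a^0=\Big\{f\in L^1(w_a):\ \int_{\mathbb{R}} f\,dx=\int_{\mathbb{R}} xf\,dx=\int_{\mathbb{R}} x^2f\,dx=0\Big\}.$$ Let $X_k$ be the space of real Borel measures $\mu$ on $\mathbb{R}$ with $\int(1+|x|)^k\,|\mu|(dx)<\infty$ and $\int\mu(dx)=\int x\,\mu(dx)=\int x^2\,\mu(dx)=0$. A function $f$ is identified with the measure $f(x)\,dx$, so that $\mathbb{Y}_a^0\subset X_k$ for $k\le a$. Let $H(x)=\frac{2}{\pi(1+x^2)^2}$, and for real Borel measures $\mu,\nu$ let $Q_0(\mu,\nu)$ be the real measure given by $$\int\phi\,dQ_0(\mu,\nu)=\iint\Big(\phi\big(\tfrac{x+y}{2}\big)-\tfrac12\phi(x)-\tfrac12\phi(y)\Big)\mu(dx)\,\nu(dy)$$ for bounded Borel $\phi$; for functions, $Q_0(f,g)(x)=\int f(x+\tfrac y2)g(x-\tfrac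 y2)\,dy-\tfrac12 f(x)\int g\,dy-\tfrac12 g(x)\int f\,dy$. On $X_k$ define the linearised operator $$\mathscr{L}h=-\tfrac14\partial_x(xh)+2Q_0(h,H),\qquad \mathscr{D}(\mathscr{L})=\{h\in X_k:\ \partial_x(xh)\in X_k\},$$ with $\partial_x$ taken in the sense of distributions. **Theorem.** Let $2<a<3$. There is a strongly continuous semigroup $(S_0(t))_{t\ge0}$ of bounded linear operators on $\big(\mathbb{Y}_a^0,\|\cdot\|_{L^1(w_a)}\big)$ such that the following holds for every $k\in(2,a]$. 1. The generator of $(S_0(t))_{t\ge0}$ is the part of $\mathscr{L}$ in $\mathbb{Y}_a^0$, that is, $\mathscr{L}$ with the domain $\{h\in\mathscr{D}(\mathscr{L})\cap\mathbb{Y}_a^0:\ \mathscr{L}h\in\mathbb{Y}_a^0\}$. 2. For every $\nu\in\big(0,\,1-\frac a4-2^{1-a}\big)$ there is a constant $C(\nu)>0$, independent of $k$, such that $$\|S_0(t)h\|_{L^1(w_a)}\le C(\nu)e^{-\nu t}\|h\|_{L^1(w_a)}\qquad\text{for all }h\in\mathbb{Y}_a^0,\ t\ge0,$$ and, with the same constant,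 $$\|\mathscr{L}h\|_{L^1(w_a)}\ge\frac{\nu}{C(\nu)}\|h\|_{L^1(w_a)}\qquad\text{for all }h\in\mathscr{D}(\mathscr{L})\cap\mathbb{Y}_a^0,$$ where $\|\mathscr{L}h\|_{L^1(w_a)}=+\infty$ if $\mathscr{L}h\notin L^1(w_a)$. -/

import Mathlib

open MeasureTheory Filter Topology
open scoped NNReal ENNReal

namespace Maxwell

noncomputable section

/-! ### Function spaces -/

/-- The weight `w_a(x) = (1 + |x|)^a`. -/
def weight (a x : ℝ) : ℝ := (1 + |x|) ^ a

/-- The weighted Lebesgue space `L¹(w_a)` of real functions, with norm `∫ |f| w_a dx`: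
the `L¹` space of the measure `w_a dx` (which has the same null sets as `dx`). -/
abbrev L1w (a : ℝ) : Type :=
  Lp ℝ 1 ((volume : Measure ℝ).withDensity fun x => ENNReal.ofReal (weight a x))

theorem volume_absolutelyContinuous (a : ℝ) : (volume : Measure ℝ) ≪
    (volume : Measure ℝ).withDensity fun x => ENNReal.ofReal (weight a x) := by
  refine withDensity_absolutelyContinuous' ?_ (Eventually.of_forall fun x => ?_)
  · unfold weight; fun_prop
  · have : 0 < weight a x := by unfold weight; positivity
    simpa using this

/-- The subspace of `L¹(w_a)` of functions with vanishing mass, momentum and energy.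
For `2 ≤ a` the integrability requirement holds for every element of `L¹(w_a)`. -/
def Y0 (a : ℝ) : Submodule ℝ (L1w a) where
  carrier := {f | ∀ j < 3, Integrable (fun x : ℝ => f x * x ^ j) ∧ ∫ x : ℝ, f x * x ^ j = 0}
  zero_mem' := by
    intro j _
    have h : (fun x : ℝ => (0 : L1w a) x * x ^ j) =ᵐ[volume] fun _ => 0 := by
      filter_upwards [(volume_absolutelyContinuous a).ae_le (Lp.coeFn_zero ℝ 1 _)] with x hx
      rw [hx, Pi.zero_apply, zero_mul]
    exact ⟨(integrable_zero _ _ _).congr h.symm, by rw [integral_congr_ae h]; simp⟩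
  add_mem' := by
    intro f g hf hg j hj
    have h : (fun x : ℝ => (f + g : L1w a) x * x ^ j) =ᵐ[volume]
        fun x => f x * x ^ j + g x * x ^ j := by
      filter_upwards [(volume_absolutelyContinuous a).ae_le (Lp.coeFn_add f g)] with x hx
      rw [hx, Pi.add_apply, add_mul]
    exact ⟨((hf j hj).1.add (hg j hj).1).congr h.symm, by
      rw [integral_congr_ae h, integral_add (hf j hj).1 (hg j hj).1, (hf j hj).2, (hg j hj).2,
        add_zero]⟩
  smul_mem' := by
    intro c f hf j hj
    have h : (fun x : ℝ => (c • f : L1w a) x * x ^ j) =ᵐ[volume]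
        fun x => c * (f x * x ^ j) := by
      filter_upwards [(volume_absolutelyContinuous a).ae_le (Lp.coeFn_smul c f)] with x hx
      rw [hx, Pi.smul_apply, smul_eq_mul, mul_assoc]
    exact ⟨((hf j hj).1.const_mul c).congr h.symm, by
      rw [integral_congr_ae h, integral_const_mul, (hf j hj).2, mul_zero]⟩

/-- The space `X_k` of real Borel measures with finite `w_k`-moment (of the total variation)
and with vanishing mass, momentum and energy. -/
def X (k : ℝ) : Set (SignedMeasure ℝ) :=
  {μ | ∫⁻ x, ENNReal.ofReal (weight k x) ∂μ.variation < ∞ ∧ ∀ j < 3, ∫ᵛ x, x ^ j ∂•μ = 0}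

/-- An element of `L¹(w_a)` seen as the real measure `f(x) dx`. -/
def toMeasure {a : ℝ} (f : L1w a) : SignedMeasure ℝ := (volume : Measure ℝ).withDensityᵥ f

/-! ### The linearised operator -/

/-- The steady profile `H(x) = 2 / (π (1 + x²)²)`. -/
def profile (x : ℝ) : ℝ := 2 / (Real.pi * (1 + x ^ 2) ^ 2)

/-- The measure `H(x) dx`. -/
def profileMeasure : SignedMeasure ℝ := (volume : Measure ℝ).withDensityᵥ profile

/-- The symmetrised collision operator `Q₀(μ, ν)` for sticky particles, on real measures: the image
of the product measure `μ ⊗ ν` under `(x, y) ↦ (x + y) / 2`, minus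
`½ ν(ℝ) μ + ½ μ(ℝ) ν`. Equivalently, for bounded measurable `φ`,
`∫ φ dQ₀(μ, ν) = ∫∫ (φ((x + y) / 2) - ½ φ(x) - ½ φ(y)) μ(dx) ν(dy)`. When `μ` and `ν` have
densities `f` and `g`, the first term has the density `x ↦ ∫ f(x + y/2) g(x - y/2) dy`. -/
def collision (μ ν : SignedMeasure ℝ) : SignedMeasure ℝ :=
  (VectorMeasure.prod μ ν (ContinuousLinearMap.mul ℝ ℝ)).map (fun p : ℝ × ℝ => (p.1 + p.2) / 2)
    - ((1 / 2 : ℝ) • (ν Set.univ • μ) + (1 / 2 : ℝ) • (μ Set.univ • ν))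

/-- `κ = ∂ₓ(x h)` in the sense of distributions on `ℝ`. -/
def IsDerivMulId (h κ : SignedMeasure ℝ) : Prop :=
  ∀ φ : ℝ → ℝ, ContDiff ℝ (⊤ : ℕ∞) φ → HasCompactSupport φ →
    ∫ᵛ x, φ x ∂•κ = -∫ᵛ x, x * deriv φ x ∂•h

/-- The graph of the linearised operator `L h = -¼ ∂ₓ(x h) + 2 Q₀(h, H)` with domain
`D(L) = {h ∈ X_k : ∂ₓ(x h) ∈ X_k}`: `LinOp k h g` means that `h ∈ D(L)` and `L h = g`. -/
def LinOp (k : ℝ) (h g : SignedMeasure ℝ) : Prop :=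
  h ∈ X k ∧ ∃ κ ∈ X k, IsDerivMulId h κ ∧
    g = -((1 / 4 : ℝ) • κ) + (2 : ℝ) • collision h profileMeasure

/-! ### Semigroups -/

section Semigroup

variable {E : Type*} [NormedAddCommGroup E] [NormedSpace ℝ E]

/-- `(S t)_{t ≥ 0}` is a strongly continuous semigroup of bounded operators on `E`. -/
structure IsStronglyContinuousSemigroup (S : ℝ≥0 → E →L[ℝ] E) : Prop where
  map_zero : S 0 = ContinuousLinearMap.id ℝ E
  map_add : ∀ s t, S (s + t) = (S s).comp (S t)
  continuous_orbit : ∀ f, Continuous fun t => S t f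

/-- `A` (given by its graph) is the infinitesimal generator of `S`: `f ∈ D(A)` and `A f = g`
if and only if `(S(t) f - f) / t → g` as `t → 0⁺`. -/
def IsGenerator (S : ℝ≥0 → E →L[ℝ] E) (A : E → E → Prop) : Prop :=
  ∀ f g, A f g ↔ Tendsto (fun t : ℝ≥0 => (t : ℝ)⁻¹ • (S t f - f)) (𝓝[≠] 0) (𝓝 g)

end Semigroup

end

end Maxwell

/-!
# Exponential stability of the linearised sticky-particle operator

On densities `h` of vanishing mass, the linearised operator is the sum of the drift `-¼ ∂ₓ(x h)`,
the loss `-h` and the gain `K h = 2 law((X + Y) / 2)`, where `X ~ h` and `Y ~ H` are independent.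
Drift and loss generate the explicit group `e^{-t} e^{-t/4} h(e^{-t/4} x)` (`lossGroup`), whose
generator is identified with the distributional derivative by duality with test functions
(`isDerivMulId_iff_tendsto`). The gain `K` is bounded on `Y0 a`, so the full semigroup comes from
the variation of constants formula (`exists_semigroup_of_perturbation`), and its generator is the
sum of the two (`linOp_iff_tendsto`).

The decay rate is that of the Fourier seminorm `F(h) = sup_ξ |ĥ(ξ)| / |ξ|^a`, which is finite on
`Y0 a` because three moments vanish and `2 ≤ a < 3`. In this seminorm the group grows at the rate
`a / 4 - 1`, and `K` has the norm at most `2^{1-a}` because it acts as `ĥ(ξ) ↦ 2 ĥ(ξ/2) Ĥ(ξ/2)`.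
To pass to the weighted `L¹` norm, split the gain at a large radius. Far from the origin the weight
bounds the gain by nearly `2^{1-a}` (`exists_gain_tail_le`). Near the origin `K h` is bounded
pointwise by `F(h)`, since `H` is a superposition of waves with the rapidly decaying amplitudes
`(1 + |ξ|) e^{-|ξ|}` (`abs_gain_le_fourierSeminorm`). Hence
`‖K h‖ ≤ (2^{1-a} + ε) ‖h‖ + C F(h)` (`exists_norm_gainY0_le`), and `K` has the norm at most
`2^{1-a} + ε` in the equivalent norm `‖h‖ + M F(h)` for large `M`. In this norm the group still
grows at the rate `a / 4 - 1`, and the rates of the group and of the bounded perturbation add up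
(`IsStronglyContinuousSemigroup.seminorm_le`).

The lower bound for the operator follows by integrating the decay of the orbits in time
(`IsStronglyContinuousSemigroup.le_norm_generator`).
-/

namespace Maxwell

noncomputable section

/-! ### Bounded perturbations of strongly continuous groups -/

section Perturbation

open scoped BoundedContinuousFunction

variable {E : Type*} [NormedAddCommGroup E] [NormedSpace ℝ E]

/-- `(T t)_{t ∈ ℝ}` is a strongly continuous group with `‖T t‖ ≤ exp (ω |t|)`. -/
structure IsGroupWithBound (T : ℝ → E →L[ℝ] E) (ω : ℝ) : Prop where
  map_zero : T 0 = ContinuousLinearMap.id ℝ E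
  map_add : ∀ s t, T (s + t) = (T s).comp (T t)
  continuous_orbit : ∀ f, Continuous fun t => T t f
  norm_le : ∀ t f, ‖T t f‖ ≤ Real.exp (ω * |t|) * ‖f‖

namespace IsGroupWithBound

variable {T : ℝ → E →L[ℝ] E} {ω : ℝ}

theorem continuous_uncurry (h : IsGroupWithBound T ω) :
    Continuous fun p : ℝ × E => T p.1 p.2 := by
  rw [continuous_iff_continuousAt]
  rintro ⟨t₀, x₀⟩
  have h1 : Tendsto (fun p : ℝ × E => Real.exp (ω * |p.1|) * ‖p.2 - x₀‖) (𝓝 (t₀, x₀)) (𝓝 0) := by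
    have : Continuous fun p : ℝ × E => Real.exp (ω * |p.1|) * ‖p.2 - x₀‖ := by fun_prop
    simpa using this.tendsto (t₀, x₀)
  have h2 : Tendsto (fun p : ℝ × E => T p.1 (p.2 - x₀)) (𝓝 (t₀, x₀)) (𝓝 0) :=
    squeeze_zero_norm (fun p => h.norm_le _ _) h1
  have h3 : Tendsto (fun p : ℝ × E => T p.1 x₀) (𝓝 (t₀, x₀)) (𝓝 (T t₀ x₀)) :=
    ((h.continuous_orbit x₀).comp continuous_fst).tendsto (t₀, x₀)
  have h4 := h2.add h3
  simp only [← _root_.map_add, sub_add_cancel, zero_add] at h4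
  exact h4

theorem continuous_apply {X : Type*} [TopologicalSpace X] (h : IsGroupWithBound T ω)
    {u : X → ℝ} {v : X → E} (hu : Continuous u) (hv : Continuous v) :
    Continuous fun x => T (u x) (v x) :=
  h.continuous_uncurry.comp (hu.prodMk hv)

end IsGroupWithBound

variable {R : ℝ → E →L[ℝ] E} {ω ρ : ℝ} {K : E →L[ℝ] E}

/-- The integrand of the variation of constants formula, for a bounded orbit `v`. -/
def duhamelIntegrand (R : ℝ → E →L[ℝ] E) (K : E →L[ℝ] E) (v : ℝ≥0 →ᵇ E) (t s : ℝ) : E :=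
  R (t - s) (K (v s.toNNReal))

theorem continuous_duhamelIntegrand (hR : IsGroupWithBound R ω) (v : ℝ≥0 →ᵇ E) :
    Continuous fun p : ℝ × ℝ => duhamelIntegrand R K v p.1 p.2 := by
  unfold duhamelIntegrand
  refine hR.continuous_apply (by fun_prop) (K.continuous.comp (v.continuous.comp ?_))
  exact continuous_real_toNNReal.comp continuous_snd

theorem continuous_duhamelIntegrand_right (hR : IsGroupWithBound R ω) (v : ℝ≥0 →ᵇ E) (t : ℝ) :
    Continuous (duhamelIntegrand R K v t) :=
  (continuous_duhamelIntegrand (K := K) hR v).comp (by fun_prop : Continuous fun s : ℝ => (t, s))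

theorem intervalIntegrable_duhamelIntegrand (hR : IsGroupWithBound R ω) (v : ℝ≥0 →ᵇ E)
    (t a b : ℝ) : IntervalIntegrable (duhamelIntegrand R K v t) volume a b :=
  (continuous_duhamelIntegrand_right hR v t).intervalIntegrable _ _

theorem norm_duhamel_le (hρ : 0 < ρ)
    (hRρ : ∀ t, 0 ≤ t → ∀ f, ‖R t f‖ ≤ Real.exp (-ρ * t) * ‖f‖) (v : ℝ≥0 →ᵇ E) (t : ℝ≥0) :
    ‖∫ s in (0 : ℝ)..t, duhamelIntegrand R K v t s‖ ≤ ‖K‖ / ρ * ‖v‖ := by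
  have hd : ∀ s : ℝ, HasDerivAt (fun s => Real.exp (-ρ * (t - s)) / ρ * (‖K‖ * ‖v‖))
      (Real.exp (-ρ * (t - s)) * (‖K‖ * ‖v‖)) s := by
    intro s
    have h1 : HasDerivAt (fun s : ℝ => -ρ * (t - s)) ρ s := by
      simpa using ((hasDerivAt_id s).const_sub (t : ℝ)).const_mul (-ρ)
    have h2 := ((h1.exp).div_const ρ).mul_const (‖K‖ * ‖v‖)
    rwa [mul_div_assoc, div_self hρ.ne', mul_one] at h2
  have hint : ∫ s in (0 : ℝ)..t, Real.exp (-ρ * (t - s)) * (‖K‖ * ‖v‖)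
      = (1 - Real.exp (-ρ * t)) / ρ * (‖K‖ * ‖v‖) := by
    rw [intervalIntegral.integral_eq_sub_of_hasDerivAt (fun s _ => hd s)
      (Continuous.intervalIntegrable (by fun_prop) _ _)]
    simp; ring
  calc ‖∫ s in (0 : ℝ)..t, duhamelIntegrand R K v t s‖
      ≤ ∫ s in (0 : ℝ)..t, Real.exp (-ρ * (t - s)) * (‖K‖ * ‖v‖) := by
        refine intervalIntegral.norm_integral_le_of_norm_le t.2 ?_
          (Continuous.intervalIntegrable (by fun_prop) _ _)
        refine Eventually.of_forall fun s hs => ?_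
        refine (hRρ _ (sub_nonneg.2 hs.2) _).trans ?_
        gcongr
        exact (K.le_opNorm _).trans (by gcongr; exact v.norm_coe_le_norm _)
    _ = (1 - Real.exp (-ρ * t)) / ρ * (‖K‖ * ‖v‖) := hint
    _ ≤ 1 / ρ * (‖K‖ * ‖v‖) := by
        gcongr
        linarith [Real.exp_pos (-ρ * t)]
    _ = ‖K‖ / ρ * ‖v‖ := by ring

/-- The orbit map `f ↦ (t ↦ R t f)`, for an exponentially stable group. -/
def orbitMap (R : ℝ → E →L[ℝ] E) (hR : IsGroupWithBound R ω) (hρ : 0 < ρ)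
    (hRρ : ∀ t, 0 ≤ t → ∀ f, ‖R t f‖ ≤ Real.exp (-ρ * t) * ‖f‖) : E →L[ℝ] (ℝ≥0 →ᵇ E) :=
  LinearMap.mkContinuous
    { toFun := fun f => BoundedContinuousFunction.ofNormedAddCommGroup (fun t : ℝ≥0 => R t f)
        ((hR.continuous_orbit f).comp NNReal.continuous_coe) ‖f‖ fun t =>
          (hRρ t t.2 f).trans (mul_le_of_le_one_left (norm_nonneg _)
            (Real.exp_le_one_iff.2 (by nlinarith [t.2])))
      map_add' := fun f g => by ext t; simp
      map_smul' := fun c f => by ext t; simp }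
    1 fun f => by
      rw [one_mul]
      exact BoundedContinuousFunction.norm_ofNormedAddCommGroup_le _ (norm_nonneg _)
        fun t : ℝ≥0 => (hRρ t t.2 f).trans (mul_le_of_le_one_left (norm_nonneg _)
          (Real.exp_le_one_iff.2 (by nlinarith [t.2])))

/-- The Volterra operator `v ↦ (t ↦ ∫₀ᵗ R (t - s) K v(s) ds)`. -/
def duhamelMap (R : ℝ → E →L[ℝ] E) (K : E →L[ℝ] E) (hR : IsGroupWithBound R ω) (hρ : 0 < ρ)
    (hRρ : ∀ t, 0 ≤ t → ∀ f, ‖R t f‖ ≤ Real.exp (-ρ * t) * ‖f‖) :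
    (ℝ≥0 →ᵇ E) →L[ℝ] (ℝ≥0 →ᵇ E) :=
  LinearMap.mkContinuous
    { toFun := fun v => BoundedContinuousFunction.ofNormedAddCommGroup
        (fun t : ℝ≥0 => ∫ s in (0 : ℝ)..t, duhamelIntegrand R K v t s)
        (intervalIntegral.continuous_parametric_intervalIntegral_of_continuous
          (f := fun (t : ℝ≥0) s => duhamelIntegrand R K v t s)
          ((continuous_duhamelIntegrand hR v).comp
            ((NNReal.continuous_coe.comp continuous_fst).prodMk continuous_snd))
          NNReal.continuous_coe)
        (‖K‖ / ρ * ‖v‖) fun t => norm_duhamel_le hρ hRρ v t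
      map_add' := fun v w => by
        ext t
        have h : ∀ s, duhamelIntegrand R K (v + w) t s
            = duhamelIntegrand R K v t s + duhamelIntegrand R K w t s := by
          intro s; simp [duhamelIntegrand]
        simp only [BoundedContinuousFunction.coe_ofNormedAddCommGroup,
          BoundedContinuousFunction.coe_add, Pi.add_apply, h]
        exact intervalIntegral.integral_add (intervalIntegrable_duhamelIntegrand hR v _ _ _)
          (intervalIntegrable_duhamelIntegrand hR w _ _ _)
      map_smul' := fun c v => by
        ext t
        have h : ∀ s, duhamelIntegrand R K (c • v) t s = c • duhamelIntegrand R K v t s := by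
          intro s; simp [duhamelIntegrand]
        simp only [BoundedContinuousFunction.coe_ofNormedAddCommGroup,
          BoundedContinuousFunction.coe_smul, h, RingHom.id_apply]
        exact intervalIntegral.integral_smul c _ }
    (‖K‖ / ρ) fun v =>
      BoundedContinuousFunction.norm_ofNormedAddCommGroup_le _ (by positivity)
        fun t => norm_duhamel_le hρ hRρ v t

theorem duhamelMap_apply (hR : IsGroupWithBound R ω) (hρ : 0 < ρ)
    (hRρ : ∀ t, 0 ≤ t → ∀ f, ‖R t f‖ ≤ Real.exp (-ρ * t) * ‖f‖) (v : ℝ≥0 →ᵇ E) (t : ℝ≥0) :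
    duhamelMap R K hR hρ hRρ v t = ∫ s in (0 : ℝ)..t, R (t - s) (K (v s.toNNReal)) := rfl

theorem norm_duhamelMap_le (hR : IsGroupWithBound R ω) (hρ : 0 < ρ)
    (hRρ : ∀ t, 0 ≤ t → ∀ f, ‖R t f‖ ≤ Real.exp (-ρ * t) * ‖f‖) :
    ‖duhamelMap R K hR hρ hRρ‖ ≤ ‖K‖ / ρ :=
  LinearMap.mkContinuous_norm_le _ (by positivity) _

theorem tendsto_coe_nnreal_nhdsNE : Tendsto (fun t : ℝ≥0 => (t : ℝ)) (𝓝[≠] 0) (𝓝[≠] 0) := by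
  refine tendsto_nhdsWithin_iff.2 ⟨?_, ?_⟩
  · exact (NNReal.continuous_coe.tendsto' 0 0 rfl).mono_left nhdsWithin_le_nhds
  · filter_upwards [self_mem_nhdsWithin] with t ht
    simpa using ht

/-- The short-time asymptotics of a solution of the variation of constants formula. -/
theorem tendsto_duhamel (hR : IsGroupWithBound R ω) [CompleteSpace E] (v : ℝ≥0 →ᵇ E) :
    Tendsto (fun t : ℝ≥0 => (t : ℝ)⁻¹ • ∫ s in (0 : ℝ)..t, R (t - s) (K (v s.toNNReal)))
      (𝓝[≠] 0) (𝓝 (K (v 0))) := by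
  have hc : Continuous fun s : ℝ => R (-s) (K (v s.toNNReal)) :=
    hR.continuous_apply (by fun_prop)
      (K.continuous.comp (v.continuous.comp continuous_real_toNNReal))
  have hd : HasDerivAt (fun t : ℝ => ∫ s in (0 : ℝ)..t, R (-s) (K (v s.toNNReal))) (K (v 0)) 0 := by
    have := intervalIntegral.integral_hasDerivAt_right (hc.intervalIntegrable 0 0)
      (hc.stronglyMeasurableAtFilter _ _) hc.continuousAt
    simpa [hR.map_zero] using this
  have hmap := tendsto_coe_nnreal_nhdsNE
  have h1 : Tendsto (fun t : ℝ≥0 => (t : ℝ)⁻¹ • ∫ s in (0 : ℝ)..t, R (-s) (K (v s.toNNReal)))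
      (𝓝[≠] 0) (𝓝 (K (v 0))) := by
    have := (hasDerivAt_iff_tendsto_slope_zero.1 hd).comp hmap
    simpa [Function.comp_def] using this
  have h2 : Tendsto (fun t : ℝ≥0 => ((t : ℝ), (t : ℝ)⁻¹ • ∫ s in (0 : ℝ)..t,
      R (-s) (K (v s.toNNReal)))) (𝓝[≠] 0) (𝓝 (0, K (v 0))) :=
    (hmap.mono_right nhdsWithin_le_nhds).prodMk_nhds h1
  have h3 := (hR.continuous_uncurry.tendsto (0, K (v 0))).comp h2
  simp only [hR.map_zero, ContinuousLinearMap.id_apply] at h3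
  refine h3.congr fun t => ?_
  simp only [Function.comp_apply, map_smul]
  rw [← ContinuousLinearMap.intervalIntegral_comp_comm _ (hc.intervalIntegrable _ _)]
  congr 1
  refine intervalIntegral.integral_congr fun s _ => ?_
  simp only [sub_eq_add_neg, hR.map_add, ContinuousLinearMap.comp_apply]

/-- A bounded perturbation of an exponentially stable group generates a semigroup, if the
perturbation is smaller than the rate of stability. The orbits are the solutions of the variation
of constants formula, which is solved by a Neumann series in the space of bounded continuous
functions on `[0, ∞)`. -/
theorem exists_semigroup_of_small_perturbation [CompleteSpace E] (hR : IsGroupWithBound R ω)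
    (hρ : 0 < ρ) (hRρ : ∀ t, 0 ≤ t → ∀ f, ‖R t f‖ ≤ Real.exp (-ρ * t) * ‖f‖) (hK : ‖K‖ < ρ) :
    ∃ S : ℝ≥0 → E →L[ℝ] E, IsStronglyContinuousSemigroup S ∧
      ∀ f, Tendsto (fun t : ℝ≥0 => (t : ℝ)⁻¹ • (S t f - R t f)) (𝓝[≠] 0) (𝓝 (K f)) := by
  set Ψ := duhamelMap R K hR hρ hRρ with hΨ
  have hΨ1 : ‖Ψ‖ < 1 := (norm_duhamelMap_le hR hρ hRρ).trans_lt ((div_lt_one hρ).2 hK)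
  set U := Units.oneSub Ψ hΨ1 with hU
  have hUval : ∀ v, U.1 v = v - Ψ v := fun v => by simp [hU]
  have hUinj : ∀ v w, v - Ψ v = w - Ψ w → v = w := by
    intro v w hvw
    have h := congrArg U⁻¹.1 ((hUval v).trans (hvw.trans (hUval w).symm))
    have hinv : ∀ z, U⁻¹.1 (U.1 z) = z := fun z => by
      rw [← mul_apply_eq_comp, Units.inv_mul]; rfl
    rwa [hinv, hinv] at h
  set J := orbitMap R hR hρ hRρ with hJ
  have hJval : ∀ f t, J f t = R t f := fun f t => rfl
  set V : E →L[ℝ] (ℝ≥0 →ᵇ E) := U⁻¹.1.comp J with hV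
  have hVeq : ∀ f, V f - Ψ (V f) = J f := by
    intro f
    rw [← hUval, hV, ContinuousLinearMap.comp_apply, ← mul_apply_eq_comp, Units.mul_inv]
    rfl
  have hVt : ∀ f (t : ℝ≥0), V f t = R t f + ∫ s in (0 : ℝ)..t, R (t - s) (K (V f s.toNNReal)) := by
    intro f t
    have := congrArg (fun v : ℝ≥0 →ᵇ E => v t) (hVeq f)
    simp only [BoundedContinuousFunction.coe_sub, Pi.sub_apply] at this
    rw [← duhamelMap_apply (K := K) hR hρ hRρ, ← hΨ, ← hJval, ← this, sub_add_cancel]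
  have hV0 : ∀ f, V f 0 = f := by
    intro f
    rw [hVt]
    simp [hR.map_zero]
  -- By uniqueness, the shifted orbit of `f` is the orbit of its value.
  have hshift : ∀ f (s t : ℝ≥0), V (V f s) t = V f (t + s) := by
    intro f s t
    set W : ℝ≥0 →ᵇ E := (V f).compContinuous ⟨fun t => t + s, by fun_prop⟩ with hW
    have hWt : ∀ t, W t = V f (t + s) := fun t => rfl
    suffices h : V (V f s) = W by rw [h, hWt]
    apply hUinj
    rw [hVeq]
    ext t
    simp only [BoundedContinuousFunction.coe_sub, Pi.sub_apply]
    rw [hΨ, duhamelMap_apply, hJval, hWt, hVt f (t + s), eq_sub_iff_add_eq, NNReal.coe_add]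
    have hc : ∀ c, Continuous fun r : ℝ => R (c - r) (K (V f r.toNNReal)) := fun c =>
      continuous_duhamelIntegrand_right hR _ c
    rw [← intervalIntegral.integral_add_adjacent_intervals
      ((hc _).intervalIntegrable 0 s) ((hc _).intervalIntegrable s (t + s)), hVt f s,
      _root_.map_add, ← ContinuousLinearMap.comp_apply, ← hR.map_add, add_assoc]
    congr 1
    congr 1
    · rw [← ContinuousLinearMap.intervalIntegral_comp_comm _ ((hc _).intervalIntegrable _ _)]
      refine intervalIntegral.integral_congr fun r _ => ?_
      simp only [add_sub_assoc, hR.map_add t, ContinuousLinearMap.comp_apply]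
    · have := intervalIntegral.integral_comp_add_right (a := 0) (b := (t : ℝ))
        (fun r : ℝ => R (t + s - r) (K (V f r.toNNReal))) (s : ℝ)
      rw [zero_add] at this
      rw [← this]
      refine intervalIntegral.integral_congr fun r hr => ?_
      rw [Set.uIcc_of_le t.coe_nonneg] at hr
      simp only [hWt, add_sub_add_right_eq_sub]
      rw [Real.toNNReal_add hr.1 s.coe_nonneg, Real.toNNReal_coe]
  refine ⟨fun t => ((BoundedContinuousFunction.evalCLM ℝ t).comp V), ⟨?_, ?_, ?_⟩, ?_⟩
  · ext f; simpa using hV0 f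
  · intro s t; ext f; simp [hshift]
  · intro f; simpa using (V f).continuous
  · intro f
    have := tendsto_duhamel (K := K) hR (V f)
    rw [hV0] at this
    refine this.congr fun t => ?_
    simp only [ContinuousLinearMap.comp_apply, BoundedContinuousFunction.evalCLM_apply]
    rw [hVt f t, add_sub_cancel_left]

/-- Bounded perturbation of a strongly continuous group: there is a semigroup that differs from the
group to first order by `t • K`. The exponential stability that the Neumann series requires is
obtained by rescaling. -/
theorem exists_semigroup_of_perturbation [CompleteSpace E] {T : ℝ → E →L[ℝ] E}
    (hT : IsGroupWithBound T ω) (hω : 0 ≤ ω) (K : E →L[ℝ] E) :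
    ∃ S : ℝ≥0 → E →L[ℝ] E, IsStronglyContinuousSemigroup S ∧
      ∀ f, Tendsto (fun t : ℝ≥0 => (t : ℝ)⁻¹ • (S t f - T t f)) (𝓝[≠] 0) (𝓝 (K f)) := by
  set l := ω + ‖K‖ + 1 with hl
  have hl0 : 0 ≤ l := by positivity
  have hR : IsGroupWithBound (fun t => Real.exp (-l * t) • T t) (l + ω) := by
    refine ⟨?_, ?_, ?_, ?_⟩
    · simp [hT.map_zero]
    · intro s t
      ext f
      simp [hT.map_add, smul_smul, add_mul, Real.exp_add, mul_comm]
    · intro f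
      have := hT.continuous_orbit f
      simp only [smul_apply]
      fun_prop
    · intro t f
      rw [smul_apply, norm_smul, Real.norm_of_nonneg (Real.exp_pos _).le]
      refine (mul_le_mul_of_nonneg_left (hT.norm_le t f) (Real.exp_pos _).le).trans ?_
      rw [← mul_assoc, ← Real.exp_add, add_mul]
      refine mul_le_mul_of_nonneg_right (Real.exp_le_exp.2 ?_) (norm_nonneg _)
      nlinarith [neg_le_abs t]
  obtain ⟨S, hS, hSK⟩ := exists_semigroup_of_small_perturbation (K := K) (ρ := ‖K‖ + 1) hR
    (by positivity) (fun t ht f => by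
      rw [smul_apply, norm_smul, Real.norm_of_nonneg (Real.exp_pos _).le]
      refine (mul_le_mul_of_nonneg_left (hT.norm_le t f) (Real.exp_pos _).le).trans ?_
      rw [← mul_assoc, ← Real.exp_add, abs_of_nonneg ht]
      gcongr
      rw [hl]; linarith) (by linarith)
  refine ⟨fun t => Real.exp (l * t) • S t, ⟨?_, ?_, ?_⟩, fun f => ?_⟩
  · simp [hS.map_zero]
  · intro s t
    ext f
    simp [hS.map_add, smul_smul, add_mul, Real.exp_add, mul_comm]
  · intro f
    have := hS.continuous_orbit f
    simp only [smul_apply]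
    fun_prop
  · have h1 : Tendsto (fun t : ℝ≥0 => Real.exp (l * t)) (𝓝[≠] 0) (𝓝 1) := by
      have : Continuous fun t : ℝ≥0 => Real.exp (l * t) := by fun_prop
      exact (this.tendsto' 0 1 (by simp)).mono_left nhdsWithin_le_nhds
    have h2 := h1.smul (hSK f)
    rw [one_smul] at h2
    refine h2.congr fun t => ?_
    simp only [smul_apply]
    rw [smul_comm, smul_sub, smul_smul, ← Real.exp_add]
    simp

theorem tendsto_sub_toNNReal_nhdsNE (t : ℝ) :
    Tendsto (fun z : ℝ => (z - t).toNNReal) (𝓝[>] t) (𝓝[≠] 0) := by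
  refine tendsto_nhdsWithin_iff.2 ⟨?_, ?_⟩
  · have : Continuous fun z : ℝ => (z - t).toNNReal := by fun_prop
    exact (this.tendsto' t 0 (by simp)).mono_left nhdsWithin_le_nhds
  · filter_upwards [self_mem_nhdsWithin] with z hz
    simpa using hz

/-- If the generator maps `f` to `g`, the orbit of `f` has the right derivative `S t g` at every
time `t`. -/
theorem IsStronglyContinuousSemigroup.hasDerivWithinAt_orbit {S : ℝ≥0 → E →L[ℝ] E}
    (hS : IsStronglyContinuousSemigroup S) {f g : E}
    (hfg : Tendsto (fun t : ℝ≥0 => (t : ℝ)⁻¹ • (S t f - f)) (𝓝[≠] 0) (𝓝 g)) {t : ℝ} (ht : 0 ≤ t) :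
    HasDerivWithinAt (fun t : ℝ => S t.toNNReal f) (S t.toNNReal g) (Set.Ici t) t := by
  rw [hasDerivWithinAt_iff_tendsto_slope, Set.Ici_sdiff_left]
  have hmap := tendsto_sub_toNNReal_nhdsNE t
  have h := ((S t.toNNReal).continuous.tendsto g).comp (hfg.comp hmap)
  refine h.congr' ?_
  filter_upwards [self_mem_nhdsWithin] with z hz
  have hz' : 0 ≤ z - t := sub_nonneg.2 (le_of_lt hz)
  have hzt : z.toNNReal = t.toNNReal + (z - t).toNNReal := by
    rw [← Real.toNNReal_add ht hz', add_sub_cancel]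
  simp only [Function.comp_apply, slope_def_module, hzt, hS.map_add,
    ContinuousLinearMap.comp_apply, map_smul, _root_.map_sub, Real.coe_toNNReal _ hz']

/-- Growth of a perturbed semigroup in a continuous seminorm: the rates of the unperturbed
group and of the perturbation add up. This is Grönwall's inequality for `t ↦ N (S t f)`, whose right
derivative is controlled by the first order expansion of `S`. -/
theorem IsStronglyContinuousSemigroup.seminorm_le {S : ℝ≥0 → E →L[ℝ] E}
    (hS : IsStronglyContinuousSemigroup S) {T : ℝ → E →L[ℝ] E} {K : E →L[ℝ] E}
    (hST : ∀ f, Tendsto (fun t : ℝ≥0 => (t : ℝ)⁻¹ • (S t f - T t f)) (𝓝[≠] 0) (𝓝 (K f)))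
    (N : Seminorm ℝ E) (hN : Continuous N) {ω k : ℝ}
    (hNT : ∀ t, 0 ≤ t → ∀ f, N (T t f) ≤ Real.exp (ω * t) * N f) (hNK : ∀ f, N (K f) ≤ k * N f)
    (t : ℝ≥0) (f : E) : N (S t f) ≤ Real.exp ((ω + k) * t) * N f := by
  set n : ℝ → ℝ := fun t => N (S t.toNNReal f) with hn
  have hnc : Continuous n := hN.comp ((hS.continuous_orbit f).comp continuous_real_toNNReal)
  have hslope : ∀ x ∈ Set.Ico (0 : ℝ) t, ∀ r, (ω + k) * n x < r →
      ∃ᶠ z in 𝓝[>] x, (z - x)⁻¹ * (n z - n x) < r := by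
    intro x hx r hr
    set g := S x.toNNReal f with hg
    have hmap := tendsto_sub_toNNReal_nhdsNE x
    have h1 := (hN.tendsto _).comp ((hST g).comp hmap)
    have h2 : Tendsto (fun z : ℝ => (z - x)⁻¹ * (Real.exp (ω * (z - x)) - 1)) (𝓝[>] x) (𝓝 ω) := by
      have hd : HasDerivAt (fun z : ℝ => Real.exp (ω * (z - x))) ω x := by
        have := ((((hasDerivAt_id x).sub_const x).const_mul ω)).exp
        simpa using this
      have := (hasDerivAt_iff_tendsto_slope.1 hd).mono_left
        (nhdsWithin_mono x fun z (hz : x < z) => hz.ne')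
      refine this.congr fun z => ?_
      simp [slope_def_field, div_eq_inv_mul]
    have h3 := (h2.mul_const (N g)).add h1
    have hlt : ω * N g + N (K g) < r := by
      refine lt_of_le_of_lt ?_ hr
      have := hNK g
      simp only [hn, ← hg]
      linarith
    refine Eventually.frequently ?_
    filter_upwards [h3.eventually_lt_const hlt, self_mem_nhdsWithin] with z hz hxz
    have hz0 : 0 < z - x := sub_pos.2 hxz
    have hzt : z.toNNReal = (z - x).toNNReal + x.toNNReal := by
      rw [← Real.toNNReal_add hz0.le hx.1, sub_add_cancel]
    have hnz : n z = N (S (z - x).toNNReal g) := by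
      simp only [hn, hzt, hS.map_add, ContinuousLinearMap.comp_apply, hg]
    refine lt_of_le_of_lt ?_ hz
    simp only [Function.comp_apply, Real.coe_toNNReal _ hz0.le]
    rw [map_smul_eq_mul, Real.norm_of_nonneg (inv_nonneg.2 hz0.le), mul_assoc, ← mul_add]
    gcongr
    have h4 : N (S (z - x).toNNReal g)
        ≤ N (S (z - x).toNNReal g - T (z - x) g) + N (T (z - x) g) := by
      simpa using map_add_le_add N (S (z - x).toNNReal g - T (z - x) g) (T (z - x) g)
    have h5 := hNT _ hz0.le g
    rw [hnz]
    have h6 : n x = N g := rfl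
    rw [h6]
    linarith
  have := le_gronwallBound_of_liminf_deriv_right_le (δ := N f) (ε := 0) hnc.continuousOn hslope
    (by simp [hn, hS.map_zero]) (fun x _ => by rw [add_zero]) t ⟨t.2, le_rfl⟩
  rw [gronwallBound_ε0, sub_zero] at this
  simpa [hn, mul_comm] using this

/-- For an exponentially stable semigroup, the generator is bounded from below: integrating
`S s g` over `s ≥ 0` recovers `-f` from `g = A f`. -/
theorem IsStronglyContinuousSemigroup.le_norm_generator {S : ℝ≥0 → E →L[ℝ] E}
    (hS : IsStronglyContinuousSemigroup S) {C ν : ℝ} (hC : 0 < C) (hν : 0 < ν)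
    (hSC : ∀ (t : ℝ≥0) f, ‖S t f‖ ≤ C * Real.exp (-ν * t) * ‖f‖) {f g : E}
    (hfg : Tendsto (fun t : ℝ≥0 => (t : ℝ)⁻¹ • (S t f - f)) (𝓝[≠] 0) (𝓝 g)) :
    ν / C * ‖f‖ ≤ ‖g‖ := by
  have hcont : Continuous fun t : ℝ => S t.toNNReal f - f :=
    ((hS.continuous_orbit f).comp continuous_real_toNNReal).sub continuous_const
  have hB : ∀ s : ℝ, HasDerivAt (fun s => C / ν * (1 - Real.exp (-ν * s)) * ‖g‖)
      (C * Real.exp (-ν * s) * ‖g‖) s := by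
    intro s
    have h1 : HasDerivAt (fun s : ℝ => -ν * s) (-ν) s := by
      simpa using (hasDerivAt_id s).const_mul (-ν)
    refine (((h1.exp.const_sub 1).const_mul (C / ν)).mul_const ‖g‖).congr_deriv ?_
    field_simp
  have key : ∀ t : ℝ, 0 ≤ t → ‖S t.toNNReal f - f‖ ≤ C / ν * ‖g‖ := by
    intro t ht
    have := image_norm_le_of_norm_deriv_right_le_deriv_boundary (a := 0) (b := t)
      (f' := fun s => S s.toNNReal g) hcont.continuousOn
      (fun s hs => (hS.hasDerivWithinAt_orbit hfg hs.1).sub_const f)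
      (B := fun s => C / ν * (1 - Real.exp (-ν * s)) * ‖g‖) (by simp [hS.map_zero]) hB
      (fun s hs => by simpa [hs.1] using hSC s.toNNReal g) ⟨ht, le_rfl⟩
    refine this.trans ?_
    gcongr
    exact mul_le_of_le_one_right (by positivity) (by linarith [Real.exp_pos (-ν * t)])
  have h1 : ∀ t : ℝ, 0 ≤ t → ‖f‖ ≤ C * Real.exp (-ν * t) * ‖f‖ + C / ν * ‖g‖ := by
    intro t ht
    have h2 := hSC t.toNNReal f
    rw [Real.coe_toNNReal _ ht] at h2
    have h3 := key t ht
    have h4 := norm_sub_norm_le f (S t.toNNReal f)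
    rw [norm_sub_rev] at h4
    linarith
  have h2 : Tendsto (fun t : ℝ => C * Real.exp (-ν * t) * ‖f‖ + C / ν * ‖g‖) atTop
      (𝓝 (C * 0 * ‖f‖ + C / ν * ‖g‖)) := by
    have : Tendsto (fun t : ℝ => Real.exp (-ν * t)) atTop (𝓝 0) :=
      Real.tendsto_exp_atBot.comp (tendsto_id.const_mul_atTop_of_neg (neg_neg_of_pos hν))
    exact ((this.const_mul C).mul_const _).add_const _
  have h3 := ge_of_tendsto h2 ((eventually_ge_atTop 0).mono h1)
  rw [mul_zero, zero_mul, zero_add] at h3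
  calc ν / C * ‖f‖ ≤ ν / C * (C / ν * ‖g‖) := by gcongr
    _ = ‖g‖ := by field_simp

end Perturbation

/-! ### The weights -/

theorem weight_pos (a x : ℝ) : 0 < weight a x := by unfold weight; positivity

@[fun_prop]
theorem continuous_weight (a : ℝ) : Continuous (weight a) := by
  unfold weight
  refine Continuous.rpow_const (by fun_prop) fun x => Or.inl ?_
  positivity

theorem one_le_weight {a : ℝ} (ha : 0 ≤ a) (x : ℝ) : 1 ≤ weight a x :=
  Real.one_le_rpow (by linarith [abs_nonneg x]) ha

theorem weight_mono {k a : ℝ} (hk : k ≤ a) (x : ℝ) : weight k x ≤ weight a x :=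
  Real.rpow_le_rpow_of_exponent_le (by linarith [abs_nonneg x]) hk

theorem abs_rpow_le_weight {a : ℝ} (ha : 0 ≤ a) (x : ℝ) : |x| ^ a ≤ weight a x :=
  Real.rpow_le_rpow (abs_nonneg x) (by linarith) ha

theorem abs_pow_le_weight {a : ℝ} {j : ℕ} (hj : (j : ℝ) ≤ a) (x : ℝ) : |x ^ j| ≤ weight a x := by
  rw [abs_pow, ← Real.rpow_natCast]
  exact (abs_rpow_le_weight (Nat.cast_nonneg j) x).trans (weight_mono hj x)

theorem weight_midpoint_le {a : ℝ} (ha : 0 ≤ a) (y z : ℝ) :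
    weight a ((y + z) / 2) ≤ weight a y * weight a z := by
  unfold weight
  rw [← Real.mul_rpow (by positivity) (by positivity)]
  refine Real.rpow_le_rpow (by positivity) ?_ ha
  rw [abs_div, abs_two]
  nlinarith [abs_add_le y z, abs_nonneg y, abs_nonneg z, mul_nonneg (abs_nonneg y) (abs_nonneg z)]

theorem weight_mul_le {a r : ℝ} (ha : 0 ≤ a) (hr : 0 ≤ r) (x : ℝ) :
    weight a (r * x) ≤ max r 1 ^ a * weight a x := by
  unfold weight
  rw [← Real.mul_rpow (by positivity) (by positivity)]
  refine Real.rpow_le_rpow (by positivity) ?_ ha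
  rw [abs_mul, abs_of_nonneg hr, mul_add, mul_one]
  exact add_le_add (le_max_right _ _) (mul_le_mul_of_nonneg_right (le_max_left _ _) (abs_nonneg x))

/-- The measure `w_a dx`. -/
abbrev wMeasure (a : ℝ) : Measure ℝ :=
  (volume : Measure ℝ).withDensity fun x => ENNReal.ofReal (weight a x)

theorem ae_wMeasure {a : ℝ} {p : ℝ → Prop} : (∀ᵐ x ∂wMeasure a, p x) ↔ ∀ᵐ x, p x :=
  ⟨fun h => (volume_absolutelyContinuous a).ae_le h,
    fun h => (withDensity_absolutelyContinuous _ _).ae_le h⟩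

theorem integrable_wMeasure_iff {F : Type*} [NormedAddCommGroup F] [NormedSpace ℝ F] {a : ℝ}
    {f : ℝ → F} :
    Integrable f (wMeasure a) ↔ Integrable fun x => weight a x • f x := by
  rw [integrable_withDensity_iff_integrable_smul' (by fun_prop)
    (Eventually.of_forall fun x => ENNReal.ofReal_lt_top)]
  simp only [ENNReal.toReal_ofReal (weight_pos a _).le]

theorem integral_wMeasure {F : Type*} [NormedAddCommGroup F] [NormedSpace ℝ F] {a : ℝ}
    (f : ℝ → F) :
    ∫ x, f x ∂wMeasure a = ∫ x, weight a x • f x := by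
  rw [integral_withDensity_eq_integral_toReal_smul (by fun_prop)
    (Eventually.of_forall fun x => ENNReal.ofReal_lt_top)]
  simp only [ENNReal.toReal_ofReal (weight_pos a _).le]

theorem aestronglyMeasurable_of_wMeasure {a : ℝ} {f : ℝ → ℝ} (hf : Integrable f (wMeasure a)) :
    AEStronglyMeasurable f volume :=
  hf.aestronglyMeasurable.mono_ac (volume_absolutelyContinuous a)

theorem integrable_weight_mul_abs {a : ℝ} {f : ℝ → ℝ} (hf : Integrable f (wMeasure a)) :
    Integrable fun x => weight a x * |f x| := by
  refine (integrable_wMeasure_iff.1 hf).norm.congr (Eventually.of_forall fun x => ?_)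
  simp [abs_of_pos (weight_pos a x)]

/-- A function dominated by the weight can be integrated against every element of `L¹(w_a)`. -/
theorem integrable_smul_of_le_weight {F : Type*} [NormedAddCommGroup F] [NormedSpace ℝ F]
    {a : ℝ} {f : ℝ → ℝ} (hf : Integrable f (wMeasure a)) {ψ : ℝ → F} (hψm : StronglyMeasurable ψ)
    {C : ℝ} (hψ : ∀ x, ‖ψ x‖ ≤ C * weight a x) : Integrable fun x => f x • ψ x := by
  refine ((integrable_weight_mul_abs hf).const_mul C).mono'
    ((aestronglyMeasurable_of_wMeasure hf).smul hψm.aestronglyMeasurable)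
    (Eventually.of_forall fun x => ?_)
  rw [norm_smul, Real.norm_eq_abs]
  nlinarith [hψ x, abs_nonneg (f x)]

theorem integrable_of_wMeasure {a : ℝ} (ha : 0 ≤ a) {f : ℝ → ℝ} (hf : Integrable f (wMeasure a)) :
    Integrable f := by
  simpa using integrable_smul_of_le_weight hf (ψ := fun _ => (1 : ℝ)) stronglyMeasurable_const
    (C := 1) (fun x => by simpa using one_le_weight ha x)

theorem norm_integral_smul_le {F : Type*} [NormedAddCommGroup F] [NormedSpace ℝ F]
    {a : ℝ} {f : ℝ → ℝ} (hf : Integrable f (wMeasure a)) {ψ : ℝ → F}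
    {C : ℝ} (hψ : ∀ x, ‖ψ x‖ ≤ C * weight a x) :
    ‖∫ x, f x • ψ x‖ ≤ C * ∫ x, weight a x * |f x| := by
  rw [← integral_const_mul]
  refine norm_integral_le_of_norm_le ((integrable_weight_mul_abs hf).const_mul C)
    (Eventually.of_forall fun x => ?_)
  rw [norm_smul, Real.norm_eq_abs]
  nlinarith [hψ x, abs_nonneg (f x)]

/-! ### The steady profile -/

theorem profile_nonneg (x : ℝ) : 0 ≤ profile x := by unfold profile; positivity

@[fun_prop]
theorem continuous_profile : Continuous profile := by
  unfold profile
  refine Continuous.div (by fun_prop) (by fun_prop) fun x => ?_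
  positivity

theorem profile_neg (x : ℝ) : profile (-x) = profile x := by simp [profile]

theorem profile_le_one (x : ℝ) : profile x ≤ 1 := by
  unfold profile
  rw [div_le_one (by positivity)]
  have h1 : 1 ≤ (1 + x ^ 2) ^ 2 := one_le_pow₀ (by nlinarith [sq_nonneg x])
  nlinarith [Real.pi_gt_three]

theorem integrable_profile_mul_weight {a : ℝ} (ha : a < 3) :
    Integrable fun x => profile x * weight a x := by
  have h : Integrable fun x : ℝ => 3 * (1 + ‖x‖) ^ (-(4 - a)) :=
    (integrable_one_add_norm (by simp; linarith)).const_mul 3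
  refine h.mono' (by fun_prop) (Eventually.of_forall fun x => ?_)
  rw [Real.norm_of_nonneg (mul_nonneg (profile_nonneg x) (weight_pos a x).le), Real.norm_eq_abs,
    neg_sub, Real.rpow_sub (by positivity)]
  unfold weight profile
  rw [mul_div_assoc', div_mul_eq_mul_div]
  have h4 : (1 + |x|) ^ (4 : ℝ) = ((1 + |x|) ^ 2) ^ 2 := by
    rw [← pow_mul]; norm_cast
  rw [h4, div_le_div_iff₀ (by positivity) (by positivity)]
  have h1 : (1 + |x|) ^ 2 ≤ 2 * (1 + x ^ 2) := by nlinarith [sq_abs x, sq_nonneg (1 - |x|)]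
  have h2 : ((1 + |x|) ^ 2) ^ 2 ≤ (2 * (1 + x ^ 2)) ^ 2 := by gcongr
  have h3 : 0 ≤ (1 + |x|) ^ a := by positivity
  have h5 : 2 * ((1 + |x|) ^ 2) ^ 2 ≤ 3 * (Real.pi * (1 + x ^ 2) ^ 2) := by
    nlinarith [Real.pi_gt_three, sq_nonneg (1 + x ^ 2)]
  nlinarith

theorem integrable_profile : Integrable profile := by
  simpa [weight] using integrable_profile_mul_weight (a := 0) (by norm_num)

theorem integral_profile : ∫ x, profile x = 1 := by
  have hd : ∀ x : ℝ, HasDerivAt (fun x => (x / (1 + x ^ 2) + Real.arctan x) / Real.pi)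
      (profile x) x := by
    intro x
    have h0 : (1 + x ^ 2) ≠ 0 := by positivity
    have h1 : HasDerivAt (fun x : ℝ => 1 + x ^ 2) (2 * x) x := by
      simpa using (hasDerivAt_pow 2 x).const_add 1
    refine ((((hasDerivAt_id x).div h1 h0).add (Real.hasDerivAt_arctan x)).div_const
      Real.pi).congr_deriv ?_
    unfold profile
    have := Real.pi_ne_zero
    simp only [id]
    field_simp
    ring
  have hb : ∀ x : ℝ, |x / (1 + x ^ 2)| ≤ |x|⁻¹ := by
    intro x
    rcases eq_or_ne x 0 with rfl | hx
    · simp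
    · rw [abs_div, abs_of_pos (by positivity : (0 : ℝ) < 1 + x ^ 2), div_le_iff₀ (by positivity)]
      have : 0 < |x| := abs_pos.2 hx
      rw [inv_mul_eq_div, le_div_iff₀ this, ← sq, sq_abs]
      linarith
  have ht : Tendsto (fun x : ℝ => (x / (1 + x ^ 2) + Real.arctan x) / Real.pi) atTop
      (𝓝 ((0 + Real.pi / 2) / Real.pi)) := by
    refine ((squeeze_zero_norm hb (tendsto_inv_atTop_zero.comp tendsto_abs_atTop_atTop)).add
      (Real.tendsto_arctan_atTop.mono_right nhdsWithin_le_nhds)).div_const _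
  have hbot : Tendsto (fun x : ℝ => (x / (1 + x ^ 2) + Real.arctan x) / Real.pi) atBot
      (𝓝 ((0 + -(Real.pi / 2)) / Real.pi)) := by
    refine ((squeeze_zero_norm hb (tendsto_inv_atTop_zero.comp tendsto_abs_atBot_atTop)).add
      (Real.tendsto_arctan_atBot.mono_right nhdsWithin_le_nhds)).div_const _
  rw [integral_of_hasDerivAt_of_tendsto hd integrable_profile hbot ht]
  have := Real.pi_ne_zero
  field_simp
  ring

/-! ### The gain operator -/

/-- The gain part `2 Q₀⁺(f, H)` of the linearised collision operator, for a density `f`: twice the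
image of `f ⊗ H` under `(y, z) ↦ (y + z) / 2`. The substitution `z = 2 x - y` contributes another
factor `2`. -/
def gain (f : ℝ → ℝ) (x : ℝ) : ℝ := 4 * ∫ y, f y * profile (2 * x - y)

theorem integrable_mul_profile {f : ℝ → ℝ} (hf : Integrable f) (x : ℝ) :
    Integrable fun y => f y * profile (2 * x - y) := by
  refine hf.mul_bdd (c := 1) (by fun_prop) (Eventually.of_forall fun y => ?_)
  rw [Real.norm_of_nonneg (profile_nonneg _)]
  exact profile_le_one _

theorem gain_congr {f g : ℝ → ℝ} (h : f =ᵐ[volume] g) : gain f = gain g := by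
  ext x
  unfold gain
  congr 1
  refine integral_congr_ae ?_
  filter_upwards [h] with y hy
  rw [hy]

theorem gain_add {f g : ℝ → ℝ} (hf : Integrable f) (hg : Integrable g) :
    gain (f + g) = gain f + gain g := by
  ext x
  simp only [gain, Pi.add_apply, add_mul]
  rw [integral_add (integrable_mul_profile hf x) (integrable_mul_profile hg x), mul_add]

theorem gain_smul (c : ℝ) (f : ℝ → ℝ) : gain (c • f) = c • gain f := by
  ext x
  simp only [gain, Pi.smul_apply, smul_eq_mul, mul_assoc, integral_const_mul]
  ring

theorem abs_gain_le (f : ℝ → ℝ) (x : ℝ) : |gain f x| ≤ gain (fun y => |f y|) x := by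
  unfold gain
  rw [abs_mul, abs_of_pos (by norm_num : (0 : ℝ) < 4)]
  refine mul_le_mul_of_nonneg_left ?_ (by norm_num)
  rw [← Real.norm_eq_abs]
  refine (norm_integral_le_integral_norm _).trans (le_of_eq ?_)
  congr 1
  ext y
  simp [abs_of_nonneg (profile_nonneg _)]

section

variable {F : Type*} [NormedAddCommGroup F] [NormedSpace ℝ F]

theorem norm_profile_smul_le {a : ℝ} (ha : 0 ≤ a) {ψ : ℝ → F} {C : ℝ}
    (hψ : ∀ x, ‖ψ x‖ ≤ C * weight a x) (y z : ℝ) :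
    ‖profile z • ψ ((y + z) / 2)‖ ≤ C * weight a y * (profile z * weight a z) := by
  have hC : 0 ≤ C := by
    have := (norm_nonneg (ψ 0)).trans (hψ 0)
    exact nonneg_of_mul_nonneg_left this (weight_pos a 0)
  rw [norm_smul, Real.norm_of_nonneg (profile_nonneg z)]
  calc profile z * ‖ψ ((y + z) / 2)‖ ≤ profile z * (C * (weight a y * weight a z)) := by
        gcongr
        · exact profile_nonneg z
        · exact (hψ _).trans (by gcongr; exact weight_midpoint_le ha y z)
    _ = C * weight a y * (profile z * weight a z) := by ring

theorem integrable_profile_smul {a : ℝ} (ha : 0 ≤ a) (ha3 : a < 3) {ψ : ℝ → F}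
    (hψm : StronglyMeasurable ψ) {C : ℝ} (hψ : ∀ x, ‖ψ x‖ ≤ C * weight a x) (y : ℝ) :
    Integrable fun z => profile z • ψ ((y + z) / 2) :=
  ((integrable_profile_mul_weight ha3).const_mul (C * weight a y)).mono'
    ((continuous_profile.stronglyMeasurable.smul
      (hψm.comp_measurable (by fun_prop))).aestronglyMeasurable)
    (Eventually.of_forall fun z => norm_profile_smul_le ha hψ y z)

/-- Absolute convergence of the double integral that pairs the gain term with a function dominated
by the weight. -/
theorem integrable_prod_gain {a : ℝ} (ha : 0 ≤ a) (ha3 : a < 3) {f : ℝ → ℝ}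
    (hf : Integrable f (wMeasure a)) {ψ : ℝ → F} (hψm : StronglyMeasurable ψ) {C : ℝ}
    (hψ : ∀ x, ‖ψ x‖ ≤ C * weight a x) :
    Integrable (fun p : ℝ × ℝ => (4 * (f p.2 * profile (2 * p.1 - p.2))) • ψ p.1)
      (volume.prod volume) := by
  have hm : AEStronglyMeasurable
      (fun p : ℝ × ℝ => (4 * (f p.2 * profile (2 * p.1 - p.2))) • ψ p.1)
      (volume.prod volume) := by
    refine AEStronglyMeasurable.smul (AEStronglyMeasurable.const_mul
      (AEStronglyMeasurable.mul (aestronglyMeasurable_of_wMeasure hf).comp_snd ?_) 4)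
      (hψm.comp_measurable measurable_fst).aestronglyMeasurable
    exact Continuous.aestronglyMeasurable (by fun_prop)
  have hk : ∀ x y : ℝ, (4 * (f y * profile (2 * x - y))) • ψ x
      = (4 * f y) • (fun z => profile z • ψ ((y + z) / 2)) (2 * x - y) := by
    intro x y
    simp only [smul_smul]
    rw [show (y + (2 * x - y)) / 2 = x by ring]
    congr 1
    ring
  rw [integrable_prod_iff' hm]
  refine ⟨Eventually.of_forall fun y => ?_, ?_⟩
  · simp only [hk]
    exact ((((integrable_profile_smul ha ha3 hψm hψ y).comp_sub_right y).comp_mul_left'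
      (two_ne_zero)).smul (4 * f y))
  · refine (((integrable_weight_mul_abs hf).const_mul
      (2 * C * ∫ z, profile z * weight a z))).mono' hm.norm.prod_swap.integral_prod_right'
      (Eventually.of_forall fun y => ?_)
    rw [Real.norm_of_nonneg (integral_nonneg fun x => norm_nonneg _)]
    simp only [hk, norm_smul (4 * f y)]
    rw [integral_const_mul]
    have h1 : ∫ x, ‖(fun z => profile z • ψ ((y + z) / 2)) (2 * x - y)‖
        = 2⁻¹ * ∫ z, ‖profile z • ψ ((y + z) / 2)‖ := by
      rw [Measure.integral_comp_mul_left
        (fun u => ‖(fun z => profile z • ψ ((y + z) / 2)) (u - y)‖) 2,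
        integral_sub_right_eq_self (fun u => ‖(fun z => profile z • ψ ((y + z) / 2)) u‖) y]
      simp
    have h2 : ∫ z, ‖profile z • ψ ((y + z) / 2)‖
        ≤ C * weight a y * ∫ z, profile z * weight a z := by
      rw [← integral_const_mul]
      exact integral_mono (integrable_profile_smul ha ha3 hψm hψ y).norm
        ((integrable_profile_mul_weight ha3).const_mul _) fun z => norm_profile_smul_le ha hψ y z
    rw [h1, norm_mul, Real.norm_of_nonneg (by norm_num : (0 : ℝ) ≤ 4), Real.norm_eq_abs]
    nlinarith [mul_le_mul_of_nonneg_left h2 (abs_nonneg (f y))]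

theorem integral_gain_integrand_smul [CompleteSpace F] (f : ℝ → ℝ) (x : ℝ) (ψ : ℝ → F) :
    ∫ y, (4 * (f y * profile (2 * x - y))) • ψ x = gain f x • ψ x := by
  rw [integral_smul_const, integral_const_mul, gain]

theorem integrable_gain_smul [CompleteSpace F] {a : ℝ} (ha : 0 ≤ a) (ha3 : a < 3) {f : ℝ → ℝ}
    (hf : Integrable f (wMeasure a)) {ψ : ℝ → F} (hψm : StronglyMeasurable ψ) {C : ℝ}
    (hψ : ∀ x, ‖ψ x‖ ≤ C * weight a x) : Integrable fun x => gain f x • ψ x := by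
  have := (integrable_prod_gain ha ha3 hf hψm hψ).integral_prod_left
  simpa only [integral_gain_integrand_smul] using this

/-- Integrals of the gain term against a test function, by exchanging the integrals and
substituting `z = 2 x - y`. -/
theorem integral_gain_smul [CompleteSpace F] {a : ℝ} (ha : 0 ≤ a) (ha3 : a < 3) {f : ℝ → ℝ}
    (hf : Integrable f (wMeasure a)) {ψ : ℝ → F} (hψm : StronglyMeasurable ψ) {C : ℝ}
    (hψ : ∀ x, ‖ψ x‖ ≤ C * weight a x) :
    ∫ x, gain f x • ψ x = ∫ y, f y • (2 : ℝ) • ∫ z, profile z • ψ ((y + z) / 2) := by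
  have h := integral_integral_swap (f := fun x y => (4 * (f y * profile (2 * x - y))) • ψ x)
    (integrable_prod_gain ha ha3 hf hψm hψ)
  simp only [integral_gain_integrand_smul] at h
  rw [h]
  congr 1
  ext y
  have hk : ∀ x : ℝ, (4 * (f y * profile (2 * x - y))) • ψ x
      = (4 * f y) • (fun z => profile z • ψ ((y + z) / 2)) (2 * x - y) := by
    intro x
    simp only [smul_smul]
    rw [show (y + (2 * x - y)) / 2 = x by ring]
    congr 1
    ring
  simp only [hk]
  rw [integral_smul, Measure.integral_comp_mul_left
        (fun u => ((fun z => profile z • ψ ((y + z) / 2)) (u - y))) 2,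
        integral_sub_right_eq_self (fun u => ((fun z => profile z • ψ ((y + z) / 2)) u)) y,
        smul_smul, smul_smul]
  congr 1
  rw [abs_of_pos (by norm_num)]
  ring

end

theorem integrable_gain {a : ℝ} (ha : 0 ≤ a) (ha3 : a < 3) {f : ℝ → ℝ}
    (hf : Integrable f (wMeasure a)) : Integrable (gain f) (wMeasure a) := by
  rw [integrable_wMeasure_iff]
  have := integrable_gain_smul ha ha3 hf (continuous_weight a).stronglyMeasurable (C := 1)
    (fun x => by rw [one_mul, Real.norm_of_nonneg (weight_pos a x).le])
  simpa only [smul_eq_mul, mul_comm] using this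

/-- The weighted `L¹` norm of the gain term on a set `A`. -/
theorem integral_indicator_gain_le {a : ℝ} (ha : 0 ≤ a) (ha3 : a < 3) {f : ℝ → ℝ}
    (hf : Integrable f (wMeasure a)) {A : Set ℝ} (hA : MeasurableSet A) {c : ℝ}
    (hc : ∀ y, 2 * ∫ z, profile z * A.indicator (weight a) ((y + z) / 2) ≤ c * weight a y) :
    ∫ x in A, weight a x * |gain f x| ≤ c * ∫ x, weight a x * |f x| := by
  have hm : StronglyMeasurable (A.indicator (weight a)) :=
    (continuous_weight a).stronglyMeasurable.indicator hA
  have hb : ∀ x, ‖A.indicator (weight a) x‖ ≤ 1 * weight a x := by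
    intro x
    rw [one_mul]
    refine (norm_indicator_le_norm_self _ _).trans (le_of_eq ?_)
    rw [Real.norm_of_nonneg (weight_pos a x).le]
  have hf' : Integrable (fun y => |f y|) (wMeasure a) := hf.abs
  have h1 := integrable_gain_smul ha ha3 hf' hm hb
  have h2 := integral_gain_smul ha ha3 hf' hm hb
  simp only [smul_eq_mul] at h1 h2
  have hind : ∀ x, A.indicator (fun x => weight a x * |gain f x|) x
      = |gain f x| * A.indicator (weight a) x := by
    intro x
    by_cases hx : x ∈ A <;> simp [hx, mul_comm]
  have hind0 : ∀ x, 0 ≤ A.indicator (weight a) x :=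
    fun x => Set.indicator_nonneg (fun x _ => (weight_pos a x).le) x
  rw [← integral_indicator hA]
  simp only [hind]
  calc ∫ x, |gain f x| * A.indicator (weight a) x
      ≤ ∫ x, gain (fun y => |f y|) x * A.indicator (weight a) x := by
        refine integral_mono_of_nonneg (Eventually.of_forall fun x => ?_) h1
          (Eventually.of_forall fun x => ?_)
        · exact mul_nonneg (abs_nonneg _) (hind0 x)
        · exact mul_le_mul_of_nonneg_right (abs_gain_le f x) (hind0 x)
    _ = ∫ y, |f y| * (2 * ∫ z, profile z * A.indicator (weight a) ((y + z) / 2)) := h2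
    _ ≤ ∫ y, c * (weight a y * |f y|) := by
        refine integral_mono_of_nonneg (Eventually.of_forall fun y => ?_)
          ((integrable_weight_mul_abs hf).const_mul c) (Eventually.of_forall fun y => ?_)
        · refine mul_nonneg (abs_nonneg _) (mul_nonneg zero_le_two (integral_nonneg fun z => ?_))
          exact mul_nonneg (profile_nonneg z) (hind0 _)
        · have := mul_le_mul_of_nonneg_left (hc y) (abs_nonneg (f y))
          simp only
          linarith
    _ = c * ∫ x, weight a x * |f x| := integral_const_mul _ _

theorem integral_gain_le {a : ℝ} (ha : 0 ≤ a) (ha3 : a < 3) {f : ℝ → ℝ}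
    (hf : Integrable f (wMeasure a)) :
    ∫ x, weight a x * |gain f x|
      ≤ (2 * ∫ z, profile z * weight a z) * ∫ x, weight a x * |f x| := by
  have := integral_indicator_gain_le ha ha3 hf MeasurableSet.univ
    (c := 2 * ∫ z, profile z * weight a z) fun y => by
      have h : ∫ z, profile z * weight a ((y + z) / 2)
          ≤ ∫ z, weight a y * (profile z * weight a z) := by
        refine integral_mono_of_nonneg (Eventually.of_forall fun z => ?_)
          ((integrable_profile_mul_weight ha3).const_mul _) (Eventually.of_forall fun z => ?_)
        · exact mul_nonneg (profile_nonneg z) (weight_pos _ _).le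
        · have := mul_le_mul_of_nonneg_left (weight_midpoint_le ha y z) (profile_nonneg z)
          simp only
          linarith
      rw [integral_const_mul] at h
      simp only [Set.indicator_univ]
      linarith
  simpa using this

/-! ### The gain term far from the origin -/

theorem tendsto_integral_tail {a : ℝ} (ha3 : a < 3) :
    Tendsto (fun n : ℕ => ∫ z in {z : ℝ | (n : ℝ) < |z|}, profile z * weight a z) atTop (𝓝 0) := by
  have h := tendsto_setIntegral_of_antitone (μ := volume)
    (s := fun n : ℕ => {z : ℝ | (n : ℝ) < |z|}) (f := fun z => profile z * weight a z)
    (fun n => (measurableSet_lt measurable_const (by fun_prop)))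
    (fun m n hmn z (hz : (n : ℝ) < |z|) => lt_of_le_of_lt (Nat.cast_le.2 hmn) hz)
    ⟨0, (integrable_profile_mul_weight ha3).integrableOn⟩
  have he : ⋂ n : ℕ, {z : ℝ | (n : ℝ) < |z|} = ∅ := by
    ext z
    simp only [Set.mem_iInter, Set.mem_ofPred_eq, Set.mem_empty_iff_false, iff_false, not_forall,
      not_lt]
    exact exists_nat_ge |z|
  simpa [he] using h

/-- For `s = 1 / (1 + |y|)`, the integrand is an upper bound of `2^a w_a((y + z) / 2) / w_a(y)`
weighted with the profile. Hence this relative growth averages to at most `1 + ε` for large `y`. -/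
theorem exists_integral_relative_weight_le {a : ℝ} (ha : 0 ≤ a) (ha3 : a < 3) {ε : ℝ} (hε : 0 < ε) :
    ∃ δ > 0, ∀ s, 0 ≤ s → s < δ →
      Integrable (fun z => profile z * (1 + (1 + |z|) * s) ^ a) ∧
      ∫ z, profile z * (1 + (1 + |z|) * s) ^ a < 1 + ε := by
  have hm : ∀ s : ℝ,
      AEStronglyMeasurable (fun z => profile z * (1 + (1 + |z|) * |s|) ^ a) volume := by
    intro s
    refine Continuous.aestronglyMeasurable (continuous_profile.mul
      (Continuous.rpow_const (by fun_prop) fun z => Or.inl ?_))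
    positivity
  have hb : ∀ s : ℝ, |s| ≤ 1 → ∀ z, ‖profile z * (1 + (1 + |z|) * |s|) ^ a‖
      ≤ 2 ^ a * (profile z * weight a z) := by
    intro s hs z
    rw [Real.norm_of_nonneg (mul_nonneg (profile_nonneg z) (by positivity))]
    have h1 : (1 + (1 + |z|) * |s|) ^ a ≤ (2 * (1 + |z|)) ^ a := by
      refine Real.rpow_le_rpow (by positivity) ?_ ha
      nlinarith [abs_nonneg z, abs_nonneg s]
    rw [Real.mul_rpow (by norm_num) (by positivity)] at h1
    calc _ ≤ profile z * (2 ^ a * (1 + |z|) ^ a) := by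
          gcongr
          exact profile_nonneg z
      _ = _ := by unfold weight; ring
  have hc : ContinuousAt (fun s : ℝ => ∫ z, profile z * (1 + (1 + |z|) * |s|) ^ a) 0 := by
    refine continuousAt_of_dominated (Eventually.of_forall hm)
      (bound := fun z => 2 ^ a * (profile z * weight a z)) ?_
      ((integrable_profile_mul_weight ha3).const_mul _) (Eventually.of_forall fun z => ?_)
    · filter_upwards [Metric.ball_mem_nhds (0 : ℝ) one_pos] with s hs
      rw [mem_ball_zero_iff, Real.norm_eq_abs] at hs
      exact Eventually.of_forall (hb s hs.le)
    · refine ContinuousAt.mul continuousAt_const (ContinuousAt.rpow_const (by fun_prop) (Or.inl ?_))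
      simp
  have h0 : ∫ z, profile z * (1 + (1 + |z|) * |(0 : ℝ)|) ^ a = 1 := by
    simp [integral_profile]
  have hev := hc.eventually_lt_const (h0.trans_lt (by linarith : (1 : ℝ) < 1 + ε))
  obtain ⟨δ, hδ, hball⟩ := Metric.eventually_nhds_iff.1 hev
  refine ⟨min δ 1, lt_min hδ one_pos, fun s hs0 hs => ?_⟩
  have hs1 : |s| ≤ 1 := by rw [abs_of_nonneg hs0]; exact (hs.trans_le (min_le_right _ _)).le
  have h1 := hball (y := s) (by
    rw [dist_zero_right, Real.norm_eq_abs, abs_of_nonneg hs0]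
    exact hs.trans_le (min_le_left _ _))
  have h2 := ((integrable_profile_mul_weight ha3).const_mul (2 ^ a)).mono' (hm s)
    (Eventually.of_forall (hb s hs1))
  rw [abs_of_nonneg hs0] at h1 h2
  exact ⟨h2, h1⟩

/-- Outside a large ball, the gain operator has nearly the norm `2^{1-a}` on `L¹(w_a)`, as it would
have with the homogeneous weight `|x|^a` and a point mass in place of the profile. -/
theorem exists_gain_tail_le {a : ℝ} (ha : 0 ≤ a) (ha3 : a < 3) {ε : ℝ} (hε : 0 < ε) :
    ∃ R, 0 ≤ R ∧ ∀ y, 2 * ∫ z, profile z * {x | R < |x|}.indicator (weight a) ((y + z) / 2)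
      ≤ (2 ^ (1 - a) + ε) * weight a y := by
  obtain ⟨δ, hδ, hδs⟩ := exists_integral_relative_weight_le ha ha3 (half_pos hε)
  obtain ⟨n, hn⟩ := ((tendsto_integral_tail ha3).eventually_lt_const (half_pos hε)).exists
  have hR : 0 ≤ (n + δ⁻¹) / 2 := by positivity
  have hind : ∀ x, ({x : ℝ | (n + δ⁻¹) / 2 < |x|}.indicator (weight a) x) ≤ weight a x :=
    fun x => Set.indicator_le_self' (fun x _ => (weight_pos a x).le) x
  have hind0 : ∀ x, 0 ≤ {x : ℝ | (n + δ⁻¹) / 2 < |x|}.indicator (weight a) x :=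
    fun x => Set.indicator_nonneg (fun x _ => (weight_pos a x).le) x
  have h2a : 0 < (2 : ℝ) ^ (1 - a) := by positivity
  refine ⟨(n + δ⁻¹) / 2, hR, fun y => ?_⟩
  by_cases hy : |y| ≤ δ⁻¹
  -- For bounded `y`, a midpoint outside the ball forces `|z| > n`, where the profile is negligible.
  · have h1 : ∫ z, profile z * {x : ℝ | (n + δ⁻¹) / 2 < |x|}.indicator (weight a) ((y + z) / 2)
        ≤ ∫ z, weight a y * {z : ℝ | (n : ℝ) < |z|}.indicator
          (fun z => profile z * weight a z) z := by
      refine integral_mono_of_nonneg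
        (Eventually.of_forall fun z => mul_nonneg (profile_nonneg z) (hind0 _)) ?_
        (Eventually.of_forall fun z => ?_)
      · exact ((integrable_profile_mul_weight ha3).indicator
          (measurableSet_lt measurable_const (by fun_prop))).const_mul _
      · simp only
        by_cases hz : (n : ℝ) < |z|
        · rw [Set.indicator_of_mem (show z ∈ {z : ℝ | (n : ℝ) < |z|} from hz)]
          have := mul_le_mul_of_nonneg_left ((hind _).trans (weight_midpoint_le ha y z))
            (profile_nonneg z)
          linarith
        · rw [Set.indicator_of_notMem (show z ∉ {z : ℝ | (n : ℝ) < |z|} from hz),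
            Set.indicator_of_notMem, mul_zero, mul_zero]
          simp only [Set.mem_ofPred_eq, not_lt] at hz ⊢
          rw [abs_div, abs_two]
          have := abs_add_le y z
          linarith
    rw [integral_const_mul,
      integral_indicator (measurableSet_lt measurable_const (by fun_prop))] at h1
    have hw := weight_pos a y
    nlinarith [mul_lt_mul_of_pos_left hn hw, mul_pos h2a hw]
  · push Not at hy
    have hy0 : 0 < 1 + |y| := by positivity
    obtain ⟨hi, hlt⟩ := hδs (1 + |y|)⁻¹ (by positivity) (by
      rw [inv_lt_comm₀ hy0 hδ]
      linarith)
    have h1 : ∫ z, profile z * {x : ℝ | (n + δ⁻¹) / 2 < |x|}.indicator (weight a) ((y + z) / 2)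
        ≤ ∫ z, 2⁻¹ ^ a * weight a y * (profile z * (1 + (1 + |z|) * (1 + |y|)⁻¹) ^ a) := by
      refine integral_mono_of_nonneg
        (Eventually.of_forall fun z => mul_nonneg (profile_nonneg z) (hind0 _)) (hi.const_mul _)
        (Eventually.of_forall fun z => ?_)
      have h3 : weight a ((y + z) / 2)
          ≤ 2⁻¹ ^ a * weight a y * (1 + (1 + |z|) * (1 + |y|)⁻¹) ^ a := by
        unfold weight
        rw [← Real.mul_rpow (by norm_num) (by positivity),
          ← Real.mul_rpow (by positivity) (by positivity)]
        refine Real.rpow_le_rpow (by positivity) ?_ ha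
        have h4 : 2⁻¹ * (1 + |y|) * (1 + (1 + |z|) * (1 + |y|)⁻¹) = (2 + |y| + |z|) / 2 := by
          field_simp
          ring
        rw [h4, abs_div, abs_two]
        linarith [abs_add_le y z]
      have := mul_le_mul_of_nonneg_left ((hind _).trans h3) (profile_nonneg z)
      simp only
      linarith
    rw [integral_const_mul] at h1
    have h5 : (2 : ℝ) ^ (1 - a) = 2 * 2⁻¹ ^ a := by
      rw [Real.rpow_sub (by norm_num), Real.rpow_one, Real.inv_rpow (by norm_num), div_eq_mul_inv]
    have h6 : (2 : ℝ)⁻¹ ^ a ≤ 1 := Real.rpow_le_one (by norm_num) (by norm_num) ha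
    have h7 : 0 < (2 : ℝ)⁻¹ ^ a := by positivity
    have hw := weight_pos a y
    have h8 := mul_lt_mul_of_pos_left hlt (mul_pos h7 hw)
    rw [h5]
    nlinarith [mul_le_mul_of_nonneg_right h6 (mul_pos hw hε).le]

/-! ### Dilations -/

/-- The dilation `e^{-t/4} f(e^{-t/4} x)`, the flow of `∂ₜ f = -¼ ∂ₓ(x f)`. -/
def dilate (t : ℝ) (f : ℝ → ℝ) (x : ℝ) : ℝ := Real.exp (-t / 4) * f (Real.exp (-t / 4) * x)

theorem exp_mul_exp_neg_div (t : ℝ) : Real.exp (t / 4) * Real.exp (-t / 4) = 1 := by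
  rw [← Real.exp_add, neg_div, add_neg_cancel, Real.exp_zero]

theorem dilate_smul_eq {F : Type*} [NormedAddCommGroup F] [NormedSpace ℝ F] (t : ℝ) (f : ℝ → ℝ)
    (ψ : ℝ → F) (x : ℝ) : dilate t f x • ψ x = Real.exp (-t / 4) •
      (fun y => f y • ψ (Real.exp (t / 4) * y)) (Real.exp (-t / 4) * x) := by
  simp only [dilate, ← mul_assoc, exp_mul_exp_neg_div, one_mul, smul_smul]

theorem integral_dilate_smul {F : Type*} [NormedAddCommGroup F] [NormedSpace ℝ F] (t : ℝ)
    (f : ℝ → ℝ) (ψ : ℝ → F) :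
    ∫ x, dilate t f x • ψ x = ∫ y, f y • ψ (Real.exp (t / 4) * y) := by
  simp only [dilate_smul_eq]
  rw [integral_smul, Measure.integral_comp_mul_left (fun y => f y • ψ (Real.exp (t / 4) * y)),
    smul_smul, abs_of_pos (by positivity), mul_inv_cancel₀ (Real.exp_pos _).ne', one_smul]

theorem dilate_congr (t : ℝ) {f g : ℝ → ℝ} (h : f =ᵐ[volume] g) :
    dilate t f =ᵐ[volume] dilate t g := by
  have := (Measure.quasiMeasurePreserving_smul volume
    (Real.exp_pos (-t / 4)).ne').ae_eq_comp h
  filter_upwards [this] with x hx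
  simp only [Function.comp_apply, smul_eq_mul] at hx
  simp only [dilate, hx]

theorem integrable_dilate {a : ℝ} (ha : 0 ≤ a) (t : ℝ) {f : ℝ → ℝ}
    (hf : Integrable f (wMeasure a)) : Integrable (dilate t f) (wMeasure a) := by
  rw [integrable_wMeasure_iff]
  have h := ((integrable_smul_of_le_weight hf
    (ψ := fun y => weight a (Real.exp (t / 4) * y))
    (Continuous.stronglyMeasurable (by fun_prop)) (C := max (Real.exp (t / 4)) 1 ^ a)
    (fun x => by
      rw [Real.norm_of_nonneg (weight_pos a _).le]
      exact weight_mul_le ha (Real.exp_pos _).le x)).comp_mul_left'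
    (Real.exp_pos (-t / 4)).ne').smul (Real.exp (-t / 4))
  refine h.congr (Eventually.of_forall fun x => ?_)
  have := dilate_smul_eq t f (weight a) x
  simp only [Pi.smul_apply]
  rw [← this, smul_eq_mul, smul_eq_mul, mul_comm]

theorem abs_dilate (t : ℝ) (f : ℝ → ℝ) (x : ℝ) : |dilate t f x| = dilate t (fun y => |f y|) x := by
  simp [dilate, abs_mul]

theorem integral_dilate_le {a : ℝ} (ha : 0 ≤ a) (t : ℝ) {f : ℝ → ℝ}
    (hf : Integrable f (wMeasure a)) :
    ∫ x, weight a x * |dilate t f x|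
      ≤ max (Real.exp (t / 4)) 1 ^ a * ∫ x, weight a x * |f x| := by
  have h := integral_dilate_smul t (fun y => |f y|) (weight a)
  simp only [smul_eq_mul] at h
  simp only [abs_dilate, mul_comm (weight a _)]
  rw [h, ← integral_const_mul]
  refine integral_mono_of_nonneg (Eventually.of_forall fun y => ?_)
    (((integrable_weight_mul_abs hf).const_mul (max (Real.exp (t / 4)) 1 ^ a)).congr
      (Eventually.of_forall fun y => by simp only; ring)) (Eventually.of_forall fun y => ?_)
  · exact mul_nonneg (abs_nonneg _) (weight_pos _ _).le
  · have := mul_le_mul_of_nonneg_left (weight_mul_le ha (Real.exp_pos (t / 4)).le y)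
      (abs_nonneg (f y))
    simp only
    linarith

theorem dilate_zero (f : ℝ → ℝ) : dilate 0 f = f := by
  ext x; simp [dilate]

theorem dilate_add (s t : ℝ) (f : ℝ → ℝ) : dilate (s + t) f = dilate s (dilate t f) := by
  ext x
  simp only [dilate]
  have : Real.exp (-(s + t) / 4) = Real.exp (-s / 4) * Real.exp (-t / 4) := by
    rw [← Real.exp_add]; ring_nf
  rw [this]
  ring_nf

/-- Continuity of dilations at the identity, for continuous functions of compact support. -/
theorem tendsto_integral_dilate_sub {a : ℝ} {g : ℝ → ℝ} (hg : Continuous g)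
    (hgs : HasCompactSupport g) :
    Tendsto (fun t => ∫ x, weight a x * |dilate t g x - g x|) (𝓝 0) (𝓝 0) := by
  obtain ⟨R, hR⟩ := (hgs.isCompact.isBounded).subset_closedBall 0
  obtain ⟨M, hM⟩ := hg.bounded_above_of_compact_support hgs
  have hM0 : 0 ≤ M := (norm_nonneg _).trans (hM 0)
  have hout : ∀ x, R < |x| → g x = 0 := by
    intro x hx
    by_contra h
    have := hR (subset_tsupport g h)
    rw [mem_closedBall_zero_iff, Real.norm_eq_abs] at this
    linarith
  set B := Metric.closedBall (0 : ℝ) (|R| * Real.exp 1) with hB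
  have hlim : ∀ x, Tendsto (fun t => weight a x * |dilate t g x - g x|) (𝓝 0) (𝓝 0) := by
    intro x
    have : Continuous fun t => weight a x * |dilate t g x - g x| := by
      unfold dilate; fun_prop
    exact this.tendsto' 0 0 (by simp [dilate])
  have h := tendsto_integral_filter_of_dominated_convergence (μ := volume) (l := 𝓝 (0 : ℝ))
    (F := fun t x => weight a x * |dilate t g x - g x|) (f := fun _ => 0)
    (B.indicator fun x => weight a x * (Real.exp 1 * M + M)) ?_ ?_ ?_
    (Eventually.of_forall hlim)
  · simpa using h
  · refine Eventually.of_forall fun t => Continuous.aestronglyMeasurable ?_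
    unfold dilate; fun_prop
  · filter_upwards [Metric.ball_mem_nhds (0 : ℝ) one_pos] with t ht
    rw [mem_ball_zero_iff, Real.norm_eq_abs, abs_lt] at ht
    refine Eventually.of_forall fun x => ?_
    rw [Real.norm_of_nonneg (mul_nonneg (weight_pos a x).le (abs_nonneg _))]
    by_cases hx : x ∈ B
    · rw [Set.indicator_of_mem hx]
      refine mul_le_mul_of_nonneg_left ?_ (weight_pos a x).le
      refine (abs_sub _ _).trans (add_le_add ?_ (hM x))
      unfold dilate
      rw [abs_mul, abs_of_pos (Real.exp_pos _)]
      exact mul_le_mul (Real.exp_le_exp.2 (by linarith)) (hM _) (abs_nonneg _) (Real.exp_pos _).le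
    · rw [Set.indicator_of_notMem hx]
      rw [hB, mem_closedBall_zero_iff, Real.norm_eq_abs, not_le] at hx
      have hx1 : R < |x| := by
        have := Real.one_le_exp (zero_le_one (α := ℝ))
        nlinarith [le_abs_self R, abs_nonneg R]
      have hx2 : R < |Real.exp (-t / 4) * x| := by
        rw [abs_mul, abs_of_pos (Real.exp_pos _)]
        have h1 : Real.exp (-1) ≤ Real.exp (-t / 4) := Real.exp_le_exp.2 (by linarith)
        have h2 : |R| < Real.exp (-1) * |x| := by
          rw [Real.exp_neg, inv_mul_eq_div, lt_div_iff₀ (Real.exp_pos 1)]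
          exact hx
        have := mul_le_mul_of_nonneg_right h1 (abs_nonneg x)
        linarith [le_abs_self R]
      simp [dilate, hout _ hx1, hout _ hx2]
  · rw [integrable_indicator_iff Metric.isClosed_closedBall.measurableSet]
    exact (Continuous.continuousOn (by fun_prop)).integrableOn_compact (isCompact_closedBall _ _)

/-- Functions of compact support are dense in `L¹(w_a)`: multiplication by the weight reduces this
to the unweighted case. -/
theorem exists_hasCompactSupport_integral_weight_sub_le {a : ℝ} {f : ℝ → ℝ}
    (hf : Integrable f (wMeasure a)) {ε : ℝ} (hε : 0 < ε) :
    ∃ g : ℝ → ℝ, HasCompactSupport g ∧ Continuous g ∧ ∫ x, weight a x * |f x - g x| ≤ ε := by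
  obtain ⟨G, hGs, hG, hGc, -⟩ :=
    (integrable_wMeasure_iff.1 hf).exists_hasCompactSupport_integral_sub_le hε
  refine ⟨fun x => (weight a x)⁻¹ * G x, hGs.mul_left, ?_, ?_⟩
  · exact ((continuous_weight a).inv₀ fun x => (weight_pos a x).ne').mul hGc
  · refine le_trans (le_of_eq ?_) hG
    congr 1
    ext x
    rw [Real.norm_eq_abs, smul_eq_mul]
    nth_rw 1 [← abs_of_pos (weight_pos a x)]
    rw [← abs_mul, mul_sub, mul_inv_cancel_left₀ (weight_pos a x).ne']

/-! ### Operators on the weighted space -/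

theorem integrable_coe {a : ℝ} (f : L1w a) : Integrable f (wMeasure a) := L1.integrable_coeFn f

theorem norm_eq_integral_weight {a : ℝ} (f : L1w a) : ‖f‖ = ∫ x, weight a x * |f x| := by
  rw [L1.norm_eq_integral_norm, integral_wMeasure]
  simp only [smul_eq_mul, Real.norm_eq_abs]

theorem L1w_ext {a : ℝ} {f g : L1w a} (h : (f : ℝ → ℝ) =ᵐ[volume] g) : f = g :=
  Lp.ext (ae_wMeasure.2 h)

theorem coeFn_add_ae {a : ℝ} (f g : L1w a) : ((f + g : L1w a) : ℝ → ℝ) =ᵐ[volume] f + g :=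
  ae_wMeasure.1 (Lp.coeFn_add f g)

theorem coeFn_sub_ae {a : ℝ} (f g : L1w a) : ((f - g : L1w a) : ℝ → ℝ) =ᵐ[volume] f - g :=
  ae_wMeasure.1 (Lp.coeFn_sub f g)

theorem coeFn_smul_ae {a : ℝ} (c : ℝ) (f : L1w a) :
    ((c • f : L1w a) : ℝ → ℝ) =ᵐ[volume] c • (f : ℝ → ℝ) :=
  ae_wMeasure.1 (Lp.coeFn_smul c f)

/-- The element of `L¹(w_a)` given by a function. -/
def mkL1w {a : ℝ} (f : ℝ → ℝ) (hf : Integrable f (wMeasure a)) : L1w a := hf.toL1 f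

theorem coeFn_mkL1w {a : ℝ} {f : ℝ → ℝ} (hf : Integrable f (wMeasure a)) :
    (mkL1w f hf : ℝ → ℝ) =ᵐ[volume] f :=
  ae_wMeasure.1 hf.coeFn_toL1

/-- The bounded operator on `L¹(w_a)` induced by a map `Φ` on functions that is compatible with
almost everywhere equality, linear and bounded. -/
def mkOp {a : ℝ} (Φ : (ℝ → ℝ) → ℝ → ℝ) (C : ℝ)
    (hcongr : ∀ f g, f =ᵐ[volume] g → Φ f =ᵐ[volume] Φ g)
    (hadd : ∀ f g, Integrable f (wMeasure a) → Integrable g (wMeasure a) →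
      Φ (f + g) = Φ f + Φ g)
    (hsmul : ∀ (c : ℝ) f, Φ (c • f) = c • Φ f)
    (hint : ∀ f, Integrable f (wMeasure a) → Integrable (Φ f) (wMeasure a))
    (hnorm : ∀ f, Integrable f (wMeasure a) →
      ∫ x, weight a x * |Φ f x| ≤ C * ∫ x, weight a x * |f x|) : L1w a →L[ℝ] L1w a :=
  LinearMap.mkContinuous
    { toFun := fun f => mkL1w (Φ f) (hint f (integrable_coe f))
      map_add' := fun f g => by
        refine L1w_ext ?_
        filter_upwards [coeFn_mkL1w (hint _ (integrable_coe (f + g))),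
          hcongr _ _ (coeFn_add_ae f g),
          coeFn_add_ae (mkL1w (Φ f) (hint f (integrable_coe f)))
            (mkL1w (Φ g) (hint g (integrable_coe g))),
          coeFn_mkL1w (hint _ (integrable_coe f)), coeFn_mkL1w (hint _ (integrable_coe g))]
          with x h1 h2 h3 h4 h5
        rw [h1, h2, h3, hadd _ _ (integrable_coe f) (integrable_coe g), Pi.add_apply, Pi.add_apply,
          h4, h5]
      map_smul' := fun c f => by
        refine L1w_ext ?_
        filter_upwards [coeFn_mkL1w (hint _ (integrable_coe (c • f))),
          hcongr _ _ (coeFn_smul_ae c f),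
          coeFn_smul_ae c (mkL1w (Φ f) (hint f (integrable_coe f))),
          coeFn_mkL1w (hint _ (integrable_coe f))] with x h1 h2 h3 h4
        rw [h1, h2, RingHom.id_apply, h3, hsmul, Pi.smul_apply, Pi.smul_apply, h4] }
    C fun f => by
      rw [norm_eq_integral_weight, norm_eq_integral_weight]
      refine le_trans (le_of_eq (integral_congr_ae ?_)) (hnorm f (integrable_coe f))
      filter_upwards [coeFn_mkL1w (hint f (integrable_coe f))] with x hx
      rw [LinearMap.coe_mk, AddHom.coe_mk, hx]

/-- The functional `f ↦ ∫ f ψ` on `L¹(w_a)`, for a function `ψ` dominated by the weight. -/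
def pairing {F : Type*} [NormedAddCommGroup F] [NormedSpace ℝ F] {a : ℝ} (ψ : ℝ → F)
    (hψm : StronglyMeasurable ψ) {C : ℝ} (hψ : ∀ x, ‖ψ x‖ ≤ C * weight a x) : L1w a →L[ℝ] F :=
  LinearMap.mkContinuous
    { toFun := fun f => ∫ x, f x • ψ x
      map_add' := fun f g => by
        rw [← integral_add (integrable_smul_of_le_weight (integrable_coe f) hψm hψ)
          (integrable_smul_of_le_weight (integrable_coe g) hψm hψ)]
        refine integral_congr_ae ?_
        filter_upwards [coeFn_add_ae f g] with x hx
        rw [hx, Pi.add_apply, add_smul]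
      map_smul' := fun c f => by
        rw [RingHom.id_apply, ← integral_smul]
        refine integral_congr_ae ?_
        filter_upwards [coeFn_smul_ae c f] with x hx
        rw [hx, Pi.smul_apply, smul_eq_mul, smul_smul] }
    C fun f => by
      rw [norm_eq_integral_weight]
      exact norm_integral_smul_le (integrable_coe f) hψ

theorem pairing_apply {F : Type*} [NormedAddCommGroup F] [NormedSpace ℝ F] {a : ℝ} {ψ : ℝ → F}
    (hψm : StronglyMeasurable ψ) {C : ℝ} (hψ : ∀ x, ‖ψ x‖ ≤ C * weight a x) (f : L1w a) :
    pairing ψ hψm hψ f = ∫ x, f x • ψ x := rfl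

section

variable {a : ℝ}

/-- The gain operator on `L¹(w_a)`. -/
def gainOp (ha : 0 ≤ a) (ha3 : a < 3) : L1w a →L[ℝ] L1w a :=
  mkOp gain (2 * ∫ z, profile z * weight a z) (fun _ _ h => (gain_congr h) ▸ EventuallyEq.rfl)
    (fun _ _ hf hg => gain_add (integrable_of_wMeasure ha hf) (integrable_of_wMeasure ha hg))
    gain_smul (fun _ hf => integrable_gain ha ha3 hf) (fun _ hf => integral_gain_le ha ha3 hf)

theorem coeFn_gainOp (ha : 0 ≤ a) (ha3 : a < 3) (f : L1w a) :
    (gainOp ha ha3 f : ℝ → ℝ) =ᵐ[volume] gain f :=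
  coeFn_mkL1w (integrable_gain ha ha3 (integrable_coe f))

/-- The dilation on `L¹(w_a)`. -/
def dilateOp (ha : 0 ≤ a) (t : ℝ) : L1w a →L[ℝ] L1w a :=
  mkOp (dilate t) (max (Real.exp (t / 4)) 1 ^ a) (fun _ _ h => dilate_congr t h)
    (fun f g _ _ => by ext x; simp [dilate, mul_add])
    (fun c f => by ext x; simp only [dilate, Pi.smul_apply, smul_eq_mul]; ring)
    (fun _ hf => integrable_dilate ha t hf) (fun _ hf => integral_dilate_le ha t hf)

theorem coeFn_dilateOp (ha : 0 ≤ a) (t : ℝ) (f : L1w a) :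
    (dilateOp ha t f : ℝ → ℝ) =ᵐ[volume] dilate t f :=
  coeFn_mkL1w (integrable_dilate ha t (integrable_coe f))

theorem norm_dilateOp_le (ha : 0 ≤ a) (t : ℝ) (f : L1w a) :
    ‖dilateOp ha t f‖ ≤ max (Real.exp (t / 4)) 1 ^ a * ‖f‖ := by
  rw [norm_eq_integral_weight, norm_eq_integral_weight]
  refine le_trans (le_of_eq (integral_congr_ae ?_)) (integral_dilate_le ha t (integrable_coe f))
  filter_upwards [coeFn_dilateOp ha t f] with x hx
  rw [hx]

theorem dilateOp_zero (ha : 0 ≤ a) (f : L1w a) : dilateOp ha 0 f = f := by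
  refine L1w_ext ?_
  filter_upwards [coeFn_dilateOp ha 0 f] with x hx
  rw [hx, dilate_zero]

theorem dilateOp_add (ha : 0 ≤ a) (s t : ℝ) (f : L1w a) :
    dilateOp ha (s + t) f = dilateOp ha s (dilateOp ha t f) := by
  refine L1w_ext ?_
  filter_upwards [coeFn_dilateOp ha (s + t) f, coeFn_dilateOp ha s (dilateOp ha t f),
    dilate_congr s (coeFn_dilateOp ha t f)] with x h1 h2 h3
  rw [h1, h2, h3, dilate_add]

theorem tendsto_dilateOp (ha : 0 ≤ a) (f : L1w a) :
    Tendsto (fun t => dilateOp ha t f) (𝓝 0) (𝓝 f) := by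
  rw [Metric.tendsto_nhds]
  intro ε hε
  have hc : Tendsto (fun t : ℝ => (max (Real.exp (t / 4)) 1 ^ a + 1) * (ε / 4)) (𝓝 0)
      (𝓝 ((1 + 1) * (ε / 4))) := by
    have : Continuous fun t : ℝ => (max (Real.exp (t / 4)) 1 ^ a + 1) * (ε / 4) := by
      refine Continuous.mul (Continuous.add (Continuous.rpow_const (by fun_prop) fun t => Or.inl ?_)
        continuous_const) continuous_const
      positivity
    exact this.tendsto' 0 _ (by simp)
  have hε4 : 0 < ε / 4 := by linarith
  obtain ⟨g, hgs, hg, hfg⟩ :=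
    exists_hasCompactSupport_integral_weight_sub_le (integrable_coe f) hε4
  have hgi : Integrable g (wMeasure a) := by
    rw [integrable_wMeasure_iff]
    have h1 : HasCompactSupport fun x => weight a x * g x := hgs.mul_left
    have h2 : Continuous fun x => weight a x * g x := (continuous_weight a).mul hg
    simpa only [smul_eq_mul] using h2.integrable_of_hasCompactSupport h1
  have hnorm : ‖f - mkL1w g hgi‖ ≤ ε / 4 := by
    rw [norm_eq_integral_weight]
    refine le_trans (le_of_eq (integral_congr_ae ?_)) hfg
    filter_upwards [coeFn_sub_ae f (mkL1w g hgi), coeFn_mkL1w hgi] with x h1 h2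
    rw [h1, Pi.sub_apply, h2]
  have hG : ∀ t, ‖dilateOp ha t (mkL1w g hgi) - mkL1w g hgi‖
      = ∫ x, weight a x * |dilate t g x - g x| := by
    intro t
    rw [norm_eq_integral_weight]
    refine integral_congr_ae ?_
    filter_upwards [coeFn_sub_ae (dilateOp ha t (mkL1w g hgi)) (mkL1w g hgi), coeFn_mkL1w hgi,
      coeFn_dilateOp ha t (mkL1w g hgi), dilate_congr t (coeFn_mkL1w hgi)] with x h1 h2 h3 h4
    rw [h1, Pi.sub_apply, h2, h3, h4]
  filter_upwards [(hc.add (tendsto_integral_dilate_sub (a := a) hg hgs)).eventually_lt_const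
    (show (1 + 1) * (ε / 4) + 0 < ε by linarith)] with t ht
  rw [dist_eq_norm]
  have hsplit : dilateOp ha t f - f = dilateOp ha t (f - mkL1w g hgi)
      + (dilateOp ha t (mkL1w g hgi) - mkL1w g hgi) - (f - mkL1w g hgi) := by
    rw [_root_.map_sub]; abel
  rw [hsplit]
  have h1 := norm_dilateOp_le ha t (f - mkL1w g hgi)
  have h2 : max (Real.exp (t / 4)) 1 ^ a * ‖f - mkL1w g hgi‖
      ≤ max (Real.exp (t / 4)) 1 ^ a * (ε / 4) := by gcongr
  have h3 := norm_sub_le (dilateOp ha t (f - mkL1w g hgi)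
      + (dilateOp ha t (mkL1w g hgi) - mkL1w g hgi)) (f - mkL1w g hgi)
  have h4 := norm_add_le (dilateOp ha t (f - mkL1w g hgi))
    (dilateOp ha t (mkL1w g hgi) - mkL1w g hgi)
  rw [hG] at h4
  linarith

theorem continuous_dilateOp (ha : 0 ≤ a) (f : L1w a) : Continuous fun t => dilateOp ha t f := by
  rw [continuous_iff_continuousAt]
  intro t
  have h1 : Tendsto (fun s => s - t) (𝓝 t) (𝓝 0) := by
    have : Continuous fun s : ℝ => s - t := by fun_prop
    exact this.tendsto' t 0 (by simp)
  have h2 := ((dilateOp ha t).continuous.tendsto f).comp ((tendsto_dilateOp ha f).comp h1)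
  refine h2.congr fun s => ?_
  simp only [Function.comp_apply]
  rw [← dilateOp_add, add_sub_cancel]

/-! ### The subspace of vanishing moments -/

theorem norm_pow_le_weight (ha : 2 ≤ a) {j : ℕ} (hj : j < 3) (x : ℝ) :
    ‖x ^ j‖ ≤ 1 * weight a x := by
  rw [one_mul]
  refine abs_pow_le_weight (le_trans ?_ ha) x
  exact_mod_cast Nat.lt_succ_iff.1 hj

theorem stronglyMeasurable_pow (j : ℕ) : StronglyMeasurable fun x : ℝ => x ^ j :=
  (continuous_pow j).stronglyMeasurable

theorem mem_Y0_iff (ha : 2 ≤ a) {f : L1w a} : f ∈ Y0 a ↔ ∀ j < 3, ∫ x, f x * x ^ j = 0 := by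
  refine ⟨fun h j hj => (h j hj).2, fun h j hj => ⟨?_, h j hj⟩⟩
  exact integrable_smul_of_le_weight (integrable_coe f) (stronglyMeasurable_pow j)
    (norm_pow_le_weight ha hj)

theorem isClosed_Y0 (ha : 2 ≤ a) : IsClosed (Y0 a : Set (L1w a)) := by
  have : (Y0 a : Set (L1w a)) = ⋂ j : Fin 3, {f | pairing (fun x : ℝ => x ^ (j : ℕ))
      (stronglyMeasurable_pow j) (norm_pow_le_weight ha j.2) f = 0} := by
    ext f
    simp only [SetLike.mem_coe, mem_Y0_iff ha, Set.mem_iInter, Set.mem_ofPred_eq, pairing_apply,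
      smul_eq_mul]
    exact ⟨fun h j => h j j.2, fun h j hj => h ⟨j, hj⟩⟩
  rw [this]
  exact isClosed_iInter fun j => isClosed_eq (ContinuousLinearMap.continuous _) continuous_const

theorem completeSpace_Y0 (ha : 2 ≤ a) : CompleteSpace (Y0 a) :=
  (isClosed_Y0 ha).completeSpace_coe

theorem dilateOp_mem_Y0 (ha : 2 ≤ a) (t : ℝ) {f : L1w a} (hf : f ∈ Y0 a) :
    dilateOp (zero_le_two.trans ha) t f ∈ Y0 a := by
  rw [mem_Y0_iff ha]
  intro j hj
  have h1 : ∫ x, dilateOp (zero_le_two.trans ha) t f x * x ^ j = ∫ x, dilate t f x • x ^ j := by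
    refine integral_congr_ae ?_
    filter_upwards [coeFn_dilateOp (zero_le_two.trans ha) t f] with x hx
    rw [hx, smul_eq_mul]
  rw [h1, integral_dilate_smul]
  simp only [smul_eq_mul, mul_pow, mul_left_comm _ (Real.exp (t / 4) ^ j)]
  rw [integral_const_mul, (hf j hj).2, mul_zero]

theorem integrable_profile_mul_pow {j : ℕ} (hj : j < 3) :
    Integrable fun z : ℝ => profile z * z ^ j := by
  have := integrable_profile_smul (a := 2) (by norm_num) (by norm_num)
    (ψ := fun x : ℝ => (2 * x) ^ j) (Continuous.stronglyMeasurable (by fun_prop)) (C := 2 ^ j)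
    (fun x => by
      rw [mul_pow, norm_mul, Real.norm_of_nonneg (by positivity)]
      have := norm_pow_le_weight (le_refl 2) hj x
      rw [one_mul] at this
      gcongr) 0
  refine this.congr (Eventually.of_forall fun z => ?_)
  simp only [smul_eq_mul, zero_add]
  rw [mul_div_cancel₀ z (two_ne_zero)]

/-- The gain operator preserves the vanishing of the moments up to order two, because
`y ↦ ∫ H(z) ((y + z) / 2)^j dz` is a polynomial of degree `j`. -/
theorem gainOp_mem_Y0 (ha : 2 ≤ a) (ha3 : a < 3) {f : L1w a} (hf : f ∈ Y0 a) :
    gainOp (zero_le_two.trans ha) ha3 f ∈ Y0 a := by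
  rw [mem_Y0_iff ha]
  intro j hj
  have h1 : ∫ x, gainOp (zero_le_two.trans ha) ha3 f x * x ^ j = ∫ x, gain f x • x ^ j := by
    refine integral_congr_ae ?_
    filter_upwards [coeFn_gainOp (zero_le_two.trans ha) ha3 f] with x hx
    rw [hx, smul_eq_mul]
  rw [h1, integral_gain_smul (by linarith) ha3 (integrable_coe f) (stronglyMeasurable_pow j)
    (norm_pow_le_weight ha hj)]
  have h2 : ∀ y : ℝ, ∫ z, profile z • ((y + z) / 2) ^ j = ∑ i ∈ Finset.range (j + 1),
      (2⁻¹ ^ j * (j.choose i : ℝ) * ∫ z, profile z * z ^ (j - i)) * y ^ i := by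
    intro y
    have h3 : ∀ z : ℝ, profile z • ((y + z) / 2) ^ j = ∑ i ∈ Finset.range (j + 1),
        (2⁻¹ ^ j * (j.choose i : ℝ) * y ^ i) * (profile z * z ^ (j - i)) := by
      intro z
      rw [div_pow, add_pow, smul_eq_mul, Finset.sum_div, Finset.mul_sum]
      refine Finset.sum_congr rfl fun i _ => ?_
      rw [inv_pow]
      field_simp
    simp only [h3]
    rw [integral_finsetSum _ fun i _ => ((integrable_profile_mul_pow (by omega)).const_mul _)]
    refine Finset.sum_congr rfl fun i _ => ?_
    rw [integral_const_mul]
    ring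
  have h4 : ∀ y : ℝ, f y • (2 : ℝ) • ∫ z, profile z • ((y + z) / 2) ^ j
      = ∑ i ∈ Finset.range (j + 1), (2 * (2⁻¹ ^ j * (j.choose i : ℝ) *
        ∫ z, profile z * z ^ (j - i))) * (f y * y ^ i) := by
    intro y
    rw [h2, smul_eq_mul, smul_eq_mul, Finset.mul_sum, Finset.mul_sum]
    refine Finset.sum_congr rfl fun i _ => ?_
    ring
  rw [integral_congr_ae (Eventually.of_forall h4), integral_finsetSum]
  · refine Finset.sum_eq_zero fun i hi => ?_
    rw [integral_const_mul, (hf i (by have := Finset.mem_range.1 hi; omega)).2, mul_zero]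
  · intro i hi
    exact ((hf i (by have := Finset.mem_range.1 hi; omega)).1.const_mul _)

/-- The restriction to `Y0 a` of an operator on `L¹(w_a)` that preserves it. -/
def restrictY0 (A : L1w a →L[ℝ] L1w a) (hA : ∀ f ∈ Y0 a, A f ∈ Y0 a) : Y0 a →L[ℝ] Y0 a :=
  (A.comp (Y0 a).subtypeL).codRestrict (Y0 a) fun f => hA f f.2

/-- The gain operator on `Y0 a`. -/
def gainY0 (ha : 2 ≤ a) (ha3 : a < 3) : Y0 a →L[ℝ] Y0 a :=
  restrictY0 (gainOp (zero_le_two.trans ha) ha3) fun _ hf => gainOp_mem_Y0 ha ha3 hf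

/-- The group on `Y0 a` generated by the loss and drift terms `-¼ ∂ₓ(x f) - f`. -/
def lossGroup (ha : 2 ≤ a) (t : ℝ) : Y0 a →L[ℝ] Y0 a :=
  Real.exp (-t) • restrictY0 (dilateOp (zero_le_two.trans ha) t) fun _ hf => dilateOp_mem_Y0 ha t hf

theorem coe_lossGroup (ha : 2 ≤ a) (t : ℝ) (f : Y0 a) :
    (lossGroup ha t f : L1w a)
      = Real.exp (-t) • dilateOp (zero_le_two.trans ha) t (f : L1w a) := rfl

theorem max_exp_rpow_of_nonneg {t : ℝ} (ht : 0 ≤ t) :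
    max (Real.exp (t / 4)) 1 ^ a = Real.exp (a / 4 * t) := by
  rw [max_eq_left (Real.one_le_exp (by linarith)), ← Real.exp_mul]
  congr 1; ring

theorem norm_lossGroup_le (ha : 2 ≤ a) {t : ℝ} (ht : 0 ≤ t) (f : Y0 a) :
    ‖lossGroup ha t f‖ ≤ Real.exp ((a / 4 - 1) * t) * ‖f‖ := by
  change ‖(lossGroup ha t f : L1w a)‖ ≤ _ * ‖(f : L1w a)‖
  rw [coe_lossGroup, norm_smul, Real.norm_of_nonneg (Real.exp_pos _).le]
  have h := norm_dilateOp_le (show 0 ≤ a by linarith) t (f : L1w a)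
  rw [max_exp_rpow_of_nonneg ht] at h
  have h2 : Real.exp ((a / 4 - 1) * t) = Real.exp (-t) * Real.exp (a / 4 * t) := by
    rw [← Real.exp_add]; ring_nf
  rw [h2, mul_assoc]
  exact mul_le_mul_of_nonneg_left h (Real.exp_pos _).le

theorem isGroupWithBound_lossGroup (ha : 2 ≤ a) (ha3 : a < 3) :
    IsGroupWithBound (lossGroup ha) 1 := by
  have ha0 : 0 ≤ a := by linarith
  refine ⟨?_, ?_, ?_, ?_⟩
  · ext1 f
    refine Subtype.ext ?_
    simp [coe_lossGroup, dilateOp_zero]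
  · intro s t
    ext1 f
    refine Subtype.ext ?_
    simp only [ContinuousLinearMap.comp_apply, coe_lossGroup, map_smul, dilateOp_add, smul_smul]
    rw [← Real.exp_add]
    congr 2
    ring
  · intro f
    refine Continuous.subtype_mk (f := fun t => Real.exp (-t) • dilateOp ha0 t (f : L1w a)) ?_ _
    exact Continuous.smul (Real.continuous_exp.comp continuous_neg) (continuous_dilateOp ha0 _)
  · intro t f
    rw [one_mul]
    rcases le_total 0 t with ht | ht
    · refine (norm_lossGroup_le ha ht f).trans ?_
      rw [abs_of_nonneg ht]
      gcongr
      nlinarith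
    · change ‖(lossGroup ha t f : L1w a)‖ ≤ _ * ‖(f : L1w a)‖
      rw [coe_lossGroup, norm_smul, Real.norm_of_nonneg (Real.exp_pos _).le,
        abs_of_nonpos ht]
      refine mul_le_mul_of_nonneg_left ?_ (Real.exp_pos _).le
      have h := norm_dilateOp_le ha0 t (f : L1w a)
      rwa [max_eq_right (Real.exp_le_one_iff.2 (by linarith)), Real.one_rpow, one_mul] at h

end

/-! ### Densities as measures, and the linearised operator on densities -/

theorem lsmul_flip_eq : (ContinuousLinearMap.lsmul ℝ ℝ : ℝ →L[ℝ] ℝ →L[ℝ] ℝ).flip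
    = ContinuousLinearMap.lsmul ℝ ℝ := by
  ext
  simp

theorem integrable_toReal_ofReal_mul {f φ : ℝ → ℝ} (hf : Integrable f) (hφ : StronglyMeasurable φ)
    (hfφ : Integrable fun x => f x * φ x) :
    Integrable fun x => (ENNReal.ofReal (f x)).toReal * φ x := by
  have hm := hf.aestronglyMeasurable.aemeasurable.ennreal_ofReal.ennreal_toReal
  refine hfφ.mono (hm.aestronglyMeasurable.mul hφ.aestronglyMeasurable)
    (Eventually.of_forall fun x => ?_)
  rw [norm_mul, norm_mul]
  refine mul_le_mul_of_nonneg_right ?_ (norm_nonneg _)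
  rw [ENNReal.toReal_ofReal', Real.norm_eq_abs, Real.norm_eq_abs, abs_of_nonneg (le_max_right _ _)]
  exact max_le (le_abs_self _) (abs_nonneg _)

/-- The integral against the real measure `f dx` is the integral of the product with the density,
by reduction to the positive and negative parts of `f`. -/
theorem integral_withDensityᵥ {f φ : ℝ → ℝ} (hf : Integrable f) (hφ : StronglyMeasurable φ)
    (hfφ : Integrable fun x => f x * φ x) :
    ∫ᵛ x, φ x ∂•((volume : Measure ℝ).withDensityᵥ f) = ∫ x, f x * φ x := by
  have hfin1 := isFiniteMeasure_withDensity_ofReal hf.2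
  have hfin2 : IsFiniteMeasure ((volume : Measure ℝ).withDensity fun x => ENNReal.ofReal (-f x)) :=
    isFiniteMeasure_withDensity_ofReal hf.neg.2
  have hpart : ∀ {h : ℝ → ℝ}, Integrable h → Integrable (fun x => h x * φ x) →
      Integrable φ ((volume : Measure ℝ).withDensity fun x => ENNReal.ofReal (h x)) ∧
      ∫ x, φ x ∂((volume : Measure ℝ).withDensity fun x => ENNReal.ofReal (h x))
        = ∫ x, (ENNReal.ofReal (h x)).toReal * φ x := by
    intro h hh hhφ
    have hm := hh.aestronglyMeasurable.aemeasurable.ennreal_ofReal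
    refine ⟨?_, ?_⟩
    · rw [integrable_withDensity_iff_integrable_smul₀' hm
        (Eventually.of_forall fun x => ENNReal.ofReal_lt_top)]
      exact integrable_toReal_ofReal_mul hh hφ hhφ
    · rw [integral_withDensity_eq_integral_toReal_smul₀ hm
        (Eventually.of_forall fun x => ENNReal.ofReal_lt_top)]
      rfl
  have hfn : Integrable fun x => -f x := hf.neg
  have hnφ : Integrable fun x => -f x * φ x := by simpa using hfφ.neg
  obtain ⟨h1, h2⟩ := hpart hf hfφ
  obtain ⟨h3, h4⟩ := hpart hfn hnφ
  have hrep := withDensityᵥ_eq_withDensity_pos_part_sub_withDensity_neg_part hf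
  rw [hrep, VectorMeasure.integral_sub_vectorMeasure, ← lsmul_flip_eq,
    VectorMeasure.integral_toSignedMeasure, VectorMeasure.integral_toSignedMeasure]
  · rw [h2, h4, ← integral_sub (integrable_toReal_ofReal_mul hf hφ hfφ)
      (integrable_toReal_ofReal_mul hfn hφ hnφ)]
    congr 1
    ext x
    rw [← sub_mul, ENNReal.toReal_ofReal', ENNReal.toReal_ofReal',
      max_zero_sub_max_neg_zero_eq_self]
  · rw [VectorMeasure.Integrable, Measure.variation_toSignedMeasure]
    exact h1
  · rw [VectorMeasure.Integrable, Measure.variation_toSignedMeasure]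
    exact h3

section

variable {a : ℝ}

theorem integrable_coe_volume (ha : 0 ≤ a) (f : L1w a) : Integrable f :=
  integrable_of_wMeasure ha (integrable_coe f)

theorem toMeasure_sub (ha : 0 ≤ a) (f g : L1w a) :
    toMeasure (f - g) = toMeasure f - toMeasure g := by
  unfold toMeasure
  rw [WithDensityᵥEq.congr_ae (coeFn_sub_ae f g),
    withDensityᵥ_sub (integrable_coe_volume ha f) (integrable_coe_volume ha g)]

theorem toMeasure_smul (c : ℝ) (f : L1w a) : toMeasure (c • f) = c • toMeasure f := by
  unfold toMeasure
  rw [WithDensityᵥEq.congr_ae (coeFn_smul_ae c f), withDensityᵥ_smul]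

theorem integral_toMeasure (ha : 0 ≤ a) (f : L1w a) {φ : ℝ → ℝ} (hφ : StronglyMeasurable φ)
    {C : ℝ} (hC : ∀ x, ‖φ x‖ ≤ C * weight a x) : ∫ᵛ x, φ x ∂•(toMeasure f) = ∫ x, f x * φ x :=
  integral_withDensityᵥ (integrable_coe_volume ha f) hφ
    (integrable_smul_of_le_weight (integrable_coe f) hφ hC)

theorem toMeasure_mem_X {k : ℝ} (hk : k ≤ a) (ha : 2 ≤ a) {f : L1w a} (hf : f ∈ Y0 a) :
    toMeasure f ∈ X k := by
  have ha0 : 0 ≤ a := by linarith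
  refine ⟨?_, fun j hj => ?_⟩
  · unfold toMeasure
    have hfi := integrable_coe_volume ha0 f
    rw [Measure.variation_withDensityᵥ hfi,
      lintegral_withDensity_eq_lintegral_mul₀ hfi.aestronglyMeasurable.enorm
        (Measurable.aemeasurable (by fun_prop))]
    refine lt_of_le_of_lt (lintegral_mono fun x => ?_)
      (integrable_weight_mul_abs (integrable_coe f)).2
    rw [Pi.mul_apply, Real.enorm_eq_ofReal_abs, Real.enorm_eq_ofReal_abs,
      ← ENNReal.ofReal_mul (abs_nonneg _), abs_mul, abs_abs, abs_of_pos (weight_pos a x)]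
    refine ENNReal.ofReal_le_ofReal ?_
    rw [mul_comm]
    exact mul_le_mul_of_nonneg_right (weight_mono hk x) (abs_nonneg _)
  · rw [integral_toMeasure ha0 f (stronglyMeasurable_pow j) (norm_pow_le_weight ha hj)]
    exact (hf j hj).2

theorem mem_Y0_of_toMeasure_mem_X {k : ℝ} (ha : 2 ≤ a) {f : L1w a} (hf : toMeasure f ∈ X k) :
    f ∈ Y0 a := by
  rw [mem_Y0_iff ha]
  intro j hj
  rw [← integral_toMeasure (by linarith) f (stronglyMeasurable_pow j) (norm_pow_le_weight ha hj)]
  exact hf.2 j hj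

theorem prod_toMeasure_profileMeasure (ha : 0 ≤ a) (f : L1w a) :
    VectorMeasure.prod (toMeasure f) profileMeasure (ContinuousLinearMap.mul ℝ ℝ)
      = ((volume : Measure ℝ).prod volume).withDensityᵥ fun p : ℝ × ℝ => f p.1 * profile p.2 := by
  have hf := integrable_coe_volume ha f
  refine VectorMeasure.prod_eq_of_forall_apply_prod fun s t hs ht => ?_
  rw [withDensityᵥ_apply (hf.mul_prod integrable_profile) (hs.prod ht),
    ← Measure.prod_restrict, integral_prod_mul, toMeasure, profileMeasure,
    withDensityᵥ_apply hf hs, withDensityᵥ_apply integrable_profile ht]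
  rfl

theorem collision_toMeasure_profileMeasure (ha : 2 ≤ a) (ha3 : a < 3) {f : L1w a}
    (hf : f ∈ Y0 a) :
    (2 : ℝ) • collision (toMeasure f) profileMeasure
      = toMeasure (gainOp (zero_le_two.trans ha) ha3 f - f) := by
  have ha0 : 0 ≤ a := by linarith
  have hfi := integrable_coe_volume ha0 f
  have hmass : toMeasure f Set.univ = 0 := by
    rw [toMeasure, withDensityᵥ_apply hfi MeasurableSet.univ, Measure.restrict_univ]
    simpa using (hf 0 (by norm_num)).2
  have hH : profileMeasure Set.univ = 1 := by
    rw [profileMeasure, withDensityᵥ_apply integrable_profile MeasurableSet.univ,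
      Measure.restrict_univ, integral_profile]
  have hmap : (2 : ℝ) • (VectorMeasure.prod (toMeasure f) profileMeasure
      (ContinuousLinearMap.mul ℝ ℝ)).map (fun p : ℝ × ℝ => (p.1 + p.2) / 2)
      = toMeasure (gainOp ha0 ha3 f) := by
    ext s hs
    have hpre : MeasurableSet ((fun p : ℝ × ℝ => (p.1 + p.2) / 2) ⁻¹' s) :=
      (by fun_prop : Measurable fun p : ℝ × ℝ => (p.1 + p.2) / 2) hs
    have hprod : Integrable (fun p : ℝ × ℝ => f p.1 * profile p.2) (volume.prod volume) :=
      hfi.mul_prod integrable_profile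
    rw [_root_.smul_apply, VectorMeasure.map_apply _ (by fun_prop) hs,
      prod_toMeasure_profileMeasure ha0 f, withDensityᵥ_apply hprod hpre, toMeasure,
      withDensityᵥ_apply (integrable_coe_volume ha0 _) hs, ← integral_indicator hpre,
      integral_prod _ (hprod.indicator hpre), ← integral_indicator hs]
    have hψ : ∀ x : ℝ, ‖s.indicator (fun _ => (1 : ℝ)) x‖ ≤ 1 * weight a x := by
      intro x
      rw [one_mul]
      refine (norm_indicator_le_norm_self _ _).trans ?_
      simpa using one_le_weight ha0 x
    have h := integral_gain_smul ha0 ha3 (integrable_coe f)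
      (stronglyMeasurable_one.indicator hs) hψ
    have h1 : ∫ x, s.indicator (gainOp ha0 ha3 f : ℝ → ℝ) x
        = ∫ x, gain f x • s.indicator (fun _ => (1 : ℝ)) x := by
      refine integral_congr_ae ?_
      filter_upwards [coeFn_gainOp ha0 ha3 f] with x hx
      by_cases hxs : x ∈ s <;> simp [hxs, hx]
    rw [h1, show (fun _ : ℝ => (1 : ℝ)) = 1 from rfl, h, ← integral_smul]
    congr 1
    ext y
    rw [smul_comm, smul_eq_mul (f y), ← integral_const_mul]
    congr 1
    congr 1
    ext z
    by_cases hz : (y + z) / 2 ∈ s <;> simp [Set.indicator, hz]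
  rw [collision, smul_sub, hmap, hmass, hH, toMeasure_sub ha0, zero_smul, smul_zero, add_zero,
    one_smul, smul_smul]
  norm_num

/-- On densities in `Y0 a`, the linearised operator is the sum of the drift, the loss and the gain
term. In particular its range consists of measures with vanishing moments. -/
theorem linOp_toMeasure_iff {k : ℝ} (hk : k ≤ a) (ha : 2 ≤ a) (ha3 : a < 3) {f : L1w a}
    (hf : f ∈ Y0 a) (g : L1w a) :
    LinOp k (toMeasure f) (toMeasure g) ↔ g ∈ Y0 a ∧
      IsDerivMulId (toMeasure f)
        (toMeasure ((4 : ℝ) • (gainOp (zero_le_two.trans ha) ha3 f - f - g))) := by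
  have ha0 : 0 ≤ a := by linarith
  have hK := gainOp_mem_Y0 ha ha3 hf
  unfold LinOp
  rw [collision_toMeasure_profileMeasure ha ha3 hf]
  constructor
  · rintro ⟨-, κ, hκ, hder, hg⟩
    have hκ' : κ = toMeasure ((4 : ℝ) • (gainOp ha0 ha3 f - f - g)) := by
      rw [toMeasure_smul, toMeasure_sub ha0 _ g, hg]
      rw [sub_add_eq_sub_sub_swap, sub_self, zero_sub, neg_neg, smul_smul]
      norm_num
    rw [hκ'] at hκ hder
    have h4 := mem_Y0_of_toMeasure_mem_X ha hκ
    refine ⟨?_, hder⟩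
    have h5 := (Y0 a).sub_mem ((Y0 a).sub_mem hK hf) ((Y0 a).smul_mem (4 : ℝ)⁻¹ h4)
    rwa [smul_smul, inv_mul_cancel₀ (by norm_num), one_smul, sub_sub_cancel] at h5
  · rintro ⟨hg, hder⟩
    refine ⟨toMeasure_mem_X hk ha hf, _, toMeasure_mem_X hk ha ((Y0 a).smul_mem _
      ((Y0 a).sub_mem ((Y0 a).sub_mem hK hf) hg)), hder, ?_⟩
    rw [toMeasure_smul, toMeasure_sub ha0 _ g, smul_smul]
    norm_num

end

/-! ### The drift as the generator of the dilations -/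

section

variable {a : ℝ}

theorem norm_le_weight_of_bound (ha : 0 ≤ a) {φ : ℝ → ℝ} {M : ℝ} (hM : ∀ x, ‖φ x‖ ≤ M) (x : ℝ) :
    ‖φ x‖ ≤ M * weight a x :=
  (hM x).trans (le_mul_of_one_le_right ((norm_nonneg _).trans (hM 0)) (one_le_weight ha x))

theorem exists_bound_mul_deriv {φ : ℝ → ℝ} (hφ : ContDiff ℝ (⊤ : ℕ∞) φ) (hs : HasCompactSupport φ) :
    ∃ B, ∀ x, ‖x * deriv φ x‖ ≤ B := by
  have h1 : HasCompactSupport fun x => x * deriv φ x := hs.deriv.mul_left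
  have h2 : Continuous fun x => x * deriv φ x :=
    continuous_id.mul (hφ.continuous_deriv (by norm_num))
  exact h2.bounded_above_of_compact_support h1

/-- The action of the dilations on a test function, differentiated in time. -/
theorem hasDerivAt_integral_dilate (ha : 0 ≤ a) (f : L1w a) {φ : ℝ → ℝ}
    (hφ : ContDiff ℝ (⊤ : ℕ∞) φ) (hs : HasCompactSupport φ) (t : ℝ) :
    HasDerivAt (fun t => ∫ y, f y * φ (Real.exp (t / 4) * y))
      (4⁻¹ * ∫ y, f y * (Real.exp (t / 4) * y * deriv φ (Real.exp (t / 4) * y))) t := by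
  obtain ⟨B, hB⟩ := exists_bound_mul_deriv hφ hs
  obtain ⟨M, hM⟩ := hφ.continuous.bounded_above_of_compact_support hs
  have hfi := integrable_coe_volume ha f
  have hφc := hφ.continuous
  have hφ'c := hφ.continuous_deriv (show (1 : WithTop ℕ∞) ≤ (⊤ : ℕ∞) by norm_num)
  have hd : ∀ s y, HasDerivAt (fun s => f y * φ (Real.exp (s / 4) * y))
      (4⁻¹ * (f y * (Real.exp (s / 4) * y * deriv φ (Real.exp (s / 4) * y)))) s := by
    intro s y
    have h1 : HasDerivAt (fun s : ℝ => Real.exp (s / 4) * y) (Real.exp (s / 4) * 4⁻¹ * y) s := by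
      simpa using ((hasDerivAt_id s).div_const 4).exp.mul_const y
    have h2 : HasDerivAt φ (deriv φ (Real.exp (s / 4) * y)) (Real.exp (s / 4) * y) :=
      ((hφ.differentiable (by norm_num)) _).hasDerivAt
    refine ((h2.comp s h1).const_mul (f y)).congr_deriv ?_
    ring
  rw [← integral_const_mul]
  refine (hasDerivAt_integral_of_dominated_loc_of_deriv_le (s := Set.univ) univ_mem
    (F := fun s y => f y * φ (Real.exp (s / 4) * y))
    (F' := fun s y => 4⁻¹ * (f y * (Real.exp (s / 4) * y * deriv φ (Real.exp (s / 4) * y))))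
    (bound := fun y => 4⁻¹ * (|f y| * B))
    (Eventually.of_forall fun s => ?_) ?_ ?_ ?_ ?_ ?_).2
  · exact hfi.aestronglyMeasurable.mul (Continuous.aestronglyMeasurable (by fun_prop))
  · exact hfi.mul_bdd (c := M) (Continuous.aestronglyMeasurable (by fun_prop))
      (Eventually.of_forall fun y => hM _)
  · exact (hfi.aestronglyMeasurable.mul (Continuous.aestronglyMeasurable (by fun_prop))).const_mul _
  · refine Eventually.of_forall fun y s _ => ?_
    rw [norm_mul, norm_mul, Real.norm_of_nonneg (by norm_num), Real.norm_eq_abs (f y)]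
    gcongr
    exact hB _
  · exact (hfi.abs.mul_const B).const_mul _
  · exact Eventually.of_forall fun y s _ => hd s y

theorem integral_dilateOp_mul (ha : 0 ≤ a) (t : ℝ) (f : L1w a) (φ : ℝ → ℝ) :
    ∫ x, dilateOp ha t f x * φ x = ∫ y, f y * φ (Real.exp (t / 4) * y) := by
  have h := integral_dilate_smul t f φ
  simp only [smul_eq_mul] at h
  rw [← h]
  refine integral_congr_ae ?_
  filter_upwards [coeFn_dilateOp ha t f] with x hx
  rw [hx]

theorem isDerivMulId_toMeasure_iff (ha : 0 ≤ a) (f κ : L1w a) :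
    IsDerivMulId (toMeasure f) (toMeasure κ) ↔ ∀ φ : ℝ → ℝ, ContDiff ℝ (⊤ : ℕ∞) φ →
      HasCompactSupport φ → ∫ x, κ x * φ x = -∫ x, f x * (x * deriv φ x) := by
  refine forall_congr' fun φ => forall_congr' fun hφ => forall_congr' fun hs => ?_
  obtain ⟨B, hB⟩ := exists_bound_mul_deriv hφ hs
  obtain ⟨M, hM⟩ := hφ.continuous.bounded_above_of_compact_support hs
  have h2 : Continuous fun x => x * deriv φ x :=
    continuous_id.mul (hφ.continuous_deriv (by norm_num))
  rw [integral_toMeasure ha κ hφ.continuous.stronglyMeasurable (norm_le_weight_of_bound ha hM),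
    integral_toMeasure ha f h2.stronglyMeasurable (norm_le_weight_of_bound ha hB)]

/-- An element of `L¹(w_a)` is determined by its integrals against test functions. -/
theorem eq_zero_of_integral_test_eq_zero (ha : 0 ≤ a) {u : L1w a}
    (h : ∀ φ : ℝ → ℝ, ContDiff ℝ (⊤ : ℕ∞) φ → HasCompactSupport φ → ∫ x, u x * φ x = 0) :
    u = 0 := by
  refine L1w_ext ?_
  have h0 : ((0 : L1w a) : ℝ → ℝ) =ᵐ[volume] 0 := ae_wMeasure.1 (Lp.coeFn_zero ℝ 1 _)
  refine EventuallyEq.trans ?_ h0.symm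
  refine ae_eq_zero_of_integral_contDiff_smul_eq_zero
    (integrable_coe_volume ha u).locallyIntegrable fun φ hφ hs => ?_
  rw [← h φ hφ hs]
  congr 1
  ext x
  rw [smul_eq_mul, mul_comm]

/-- If `κ = ∂ₓ(x f)` in the sense of distributions, the orbit of `f` under the dilations is the
integral of the orbit of `-κ / 4`: both sides have the same integrals against test functions. -/
theorem dilateOp_sub_eq_integral (ha : 0 ≤ a) {f κ : L1w a}
    (h : IsDerivMulId (toMeasure f) (toMeasure κ)) (t : ℝ) :
    dilateOp ha t f - f = -((4 : ℝ)⁻¹ • ∫ s in (0 : ℝ)..t, dilateOp ha s κ) := by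
  rw [← sub_eq_zero, sub_neg_eq_add]
  refine eq_zero_of_integral_test_eq_zero ha fun φ hφ hs => ?_
  rw [isDerivMulId_toMeasure_iff ha] at h
  obtain ⟨M, hM⟩ := hφ.continuous.bounded_above_of_compact_support hs
  set P : L1w a →L[ℝ] ℝ := pairing φ hφ.continuous.stronglyMeasurable
    (norm_le_weight_of_bound ha hM) with hP
  have hPv : ∀ u : L1w a, P u = ∫ x, u x * φ x := fun u => rfl
  have hc := continuous_dilateOp ha κ
  have hderiv : ∀ t, HasDerivAt (fun t => P (dilateOp ha t f - f
      + (4 : ℝ)⁻¹ • ∫ s in (0 : ℝ)..t, dilateOp ha s κ)) 0 t := by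
    intro t
    have h1 := hasDerivAt_integral_dilate ha f hφ hs t
    have h2 : HasDerivAt (fun t => ∫ s in (0 : ℝ)..t, dilateOp ha s κ) (dilateOp ha t κ) t :=
      intervalIntegral.integral_hasDerivAt_right (hc.intervalIntegrable _ _)
        (hc.stronglyMeasurableAtFilter _ _) hc.continuousAt
    have h3 := (P.hasFDerivAt.comp_hasDerivAt t h2).const_mul (4 : ℝ)⁻¹
    have h4 := (h1.sub_const (P f)).add h3
    have hdil : ContDiff ℝ (⊤ : ℕ∞) fun y => φ (Real.exp (t / 4) * y) :=
      hφ.comp (contDiff_const.mul contDiff_id)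
    have hdils : HasCompactSupport fun y => φ (Real.exp (t / 4) * y) :=
      hs.comp_homeomorph (Homeomorph.mulLeft₀ _ (Real.exp_pos (t / 4)).ne')
    have h5 := h _ hdil hdils
    have h6 : ∀ y, deriv (fun y => φ (Real.exp (t / 4) * y)) y
        = Real.exp (t / 4) * deriv φ (Real.exp (t / 4) * y) := by
      intro y
      rw [deriv_comp_mul_left, smul_eq_mul]
    have h7 : P (dilateOp ha t κ)
        = -∫ y, f y * (Real.exp (t / 4) * y * deriv φ (Real.exp (t / 4) * y)) := by
      rw [hPv, integral_dilateOp_mul, h5]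
      congr 2
      ext y
      rw [h6]
      ring
    rw [h7] at h4
    refine (h4.congr_deriv (by ring)).congr_of_eventuallyEq (Eventually.of_forall fun t => ?_)
    simp only [Pi.add_apply, Function.comp_apply]
    rw [_root_.map_add, _root_.map_sub, map_smul, smul_eq_mul, hPv (dilateOp ha t f),
      integral_dilateOp_mul]
  have hconst := is_const_of_deriv_eq_zero (fun t => (hderiv t).differentiableAt)
    (fun t => (hderiv t).deriv) t 0
  simp only [dilateOp_zero, sub_self, intervalIntegral.integral_same, smul_zero, add_zero,
    _root_.map_zero] at hconst
  rw [← hPv]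
  exact hconst

/-- The generator of the dilations is `f ↦ -¼ ∂ₓ(x f)`, in the sense of distributions. -/
theorem isDerivMulId_iff_tendsto (ha : 0 ≤ a) (f κ : L1w a) :
    IsDerivMulId (toMeasure f) (toMeasure κ) ↔
      Tendsto (fun t : ℝ≥0 => (t : ℝ)⁻¹ • (dilateOp ha t f - f)) (𝓝[≠] 0)
        (𝓝 (-((4 : ℝ)⁻¹ • κ))) := by
  constructor
  · intro h
    have hc := continuous_dilateOp ha κ
    have h2 : HasDerivAt (fun t => ∫ s in (0 : ℝ)..t, dilateOp ha s κ) (dilateOp ha 0 κ) 0 :=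
      intervalIntegral.integral_hasDerivAt_right (hc.intervalIntegrable _ _)
        (hc.stronglyMeasurableAtFilter _ _) hc.continuousAt
    have h3 := (hasDerivAt_iff_tendsto_slope_zero.1
      ((h2.const_smul (4 : ℝ)⁻¹).neg)).comp tendsto_coe_nnreal_nhdsNE
    rw [dilateOp_zero] at h3
    refine h3.congr fun t => ?_
    simp only [Function.comp_apply, Pi.neg_apply, Pi.smul_apply, zero_add,
      intervalIntegral.integral_same, smul_zero, neg_zero, sub_zero]
    rw [dilateOp_sub_eq_integral ha h]
  · intro h
    rw [isDerivMulId_toMeasure_iff ha]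
    intro φ hφ hs
    obtain ⟨M, hM⟩ := hφ.continuous.bounded_above_of_compact_support hs
    set P : L1w a →L[ℝ] ℝ := pairing φ hφ.continuous.stronglyMeasurable
      (norm_le_weight_of_bound ha hM) with hP
    have hPv : ∀ u : L1w a, P u = ∫ x, u x * φ x := fun u => rfl
    have h1 := (hasDerivAt_iff_tendsto_slope_zero.1
      (hasDerivAt_integral_dilate ha f hφ hs 0)).comp tendsto_coe_nnreal_nhdsNE
    have h2 := (P.continuous.tendsto _).comp h
    have h3 : ∀ t : ℝ≥0, P ((t : ℝ)⁻¹ • (dilateOp ha t f - f))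
        = (t : ℝ)⁻¹ • ((∫ y, f y * φ (Real.exp ((0 + t) / 4) * y))
          - ∫ y, f y * φ (Real.exp (0 / 4) * y)) := by
      intro t
      rw [map_smul, _root_.map_sub, hPv, integral_dilateOp_mul, hPv]
      simp
    have hne : (𝓝[≠] (0 : ℝ≥0)).NeBot := inferInstance
    have h4 := tendsto_nhds_unique (h2.congr fun t => h3 t) h1
    rw [_root_.map_neg, map_smul, hPv] at h4
    simp only [smul_eq_mul, zero_div, Real.exp_zero, one_mul] at h4
    linarith

/-- The generator of the perturbed semigroup is the part of the linearised operator in `Y0 a`. -/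
theorem linOp_iff_tendsto {k : ℝ} (hk : k ≤ a) (ha : 2 ≤ a) (ha3 : a < 3)
    {S : ℝ≥0 → Y0 a →L[ℝ] Y0 a}
    (hS : ∀ f, Tendsto (fun t : ℝ≥0 => (t : ℝ)⁻¹ • (S t f - lossGroup ha t f)) (𝓝[≠] 0)
      (𝓝 (gainY0 ha ha3 f))) (f g : Y0 a) :
    LinOp k (toMeasure (f : L1w a)) (toMeasure (g : L1w a)) ↔
      Tendsto (fun t : ℝ≥0 => (t : ℝ)⁻¹ • (S t f - f)) (𝓝[≠] 0) (𝓝 g) := by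
  have ha0 : 0 ≤ a := by linarith
  rw [linOp_toMeasure_iff hk ha ha3 f.2, and_iff_right g.2, isDerivMulId_iff_tendsto ha0]
  have hexp : Tendsto
      (fun t : ℝ≥0 => ((t : ℝ)⁻¹ * (Real.exp (-t) - 1)) • dilateOp ha0 t (f : L1w a))
      (𝓝[≠] 0) (𝓝 ((-1 : ℝ) • (f : L1w a))) := by
    have h1 : HasDerivAt (fun t : ℝ => Real.exp (-t)) (-1) 0 := by
      simpa using (hasDerivAt_neg (0 : ℝ)).exp
    have h2 := (hasDerivAt_iff_tendsto_slope_zero.1 h1).comp tendsto_coe_nnreal_nhdsNE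
    have h3 := (tendsto_dilateOp ha0 (f : L1w a)).comp
      (tendsto_coe_nnreal_nhdsNE.mono_right nhdsWithin_le_nhds)
    refine (h2.smul h3).congr fun t => ?_
    simp
  have hS' := tendsto_subtype_rng.1 (hS f)
  have hsplit : ∀ t : ℝ≥0, (((t : ℝ)⁻¹ • (S t f - f) : Y0 a) : L1w a)
      = (t : ℝ)⁻¹ • (dilateOp ha0 t (f : L1w a) - f)
        + (((t : ℝ)⁻¹ * (Real.exp (-t) - 1)) • dilateOp ha0 t (f : L1w a)
          + (((t : ℝ)⁻¹ • (S t f - lossGroup ha t f) : Y0 a) : L1w a)) := by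
    intro t
    simp only [Submodule.coe_smul, Submodule.coe_sub, coe_lossGroup]
    module
  rw [tendsto_subtype_rng]
  constructor
  · intro h
    have h1 := h.add (hexp.add hS')
    refine (h1.congr fun t => (hsplit t).symm).trans (le_of_eq ?_)
    congr 1
    change _ + (_ + gainOp ha0 ha3 (f : L1w a)) = _
    module
  · intro h
    have h1 := h.sub (hexp.add hS')
    refine (h1.congr fun t => by rw [hsplit t, add_sub_cancel_right]).trans (le_of_eq ?_)
    congr 1
    change _ - (_ + gainOp ha0 ha3 (f : L1w a)) = _
    module

end

/-! ### The Fourier seminorm -/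

section

variable {a : ℝ}

/-- The character `x ↦ exp(i ξ x)`. -/
def character (ξ x : ℝ) : ℂ := Complex.exp ((ξ * x : ℝ) * Complex.I)

theorem norm_character (ξ x : ℝ) : ‖character ξ x‖ = 1 := Complex.norm_exp_ofReal_mul_I _

@[fun_prop]
theorem continuous_uncurry_character : Continuous fun p : ℝ × ℝ => character p.1 p.2 := by
  unfold character; fun_prop

theorem continuous_character (ξ : ℝ) : Continuous (character ξ) :=
  continuous_uncurry_character.comp (by fun_prop : Continuous fun x : ℝ => (ξ, x))

theorem character_le_weight (ha : 0 ≤ a) (ξ x : ℝ) : ‖character ξ x‖ ≤ 1 * weight a x := by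
  rw [norm_character, one_mul]
  exact one_le_weight ha x

/-- The Fourier transform at the frequency `ξ`, as a functional on `L¹(w_a)`. -/
def transform (ha : 0 ≤ a) (ξ : ℝ) : L1w a →L[ℝ] ℂ :=
  pairing (character ξ) (continuous_character ξ).stronglyMeasurable (character_le_weight ha ξ)

theorem transform_apply (ha : 0 ≤ a) (ξ : ℝ) (f : L1w a) :
    transform ha ξ f = ∫ x, f x • character ξ x := rfl

/-- The second order Taylor remainder, estimated by interpolation between its cubic bound for
`|θ| ≤ 1` and its quadratic bound for `|θ| ≥ 1`. -/
theorem norm_exp_sub_taylor_le (ha : 2 ≤ a) (ha3 : a ≤ 3) (θ : ℝ) :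
    ‖Complex.exp (θ * Complex.I) - (1 + θ * Complex.I - (θ ^ 2 / 2 : ℝ))‖ ≤ 4 * |θ| ^ a := by
  rcases le_total |θ| 1 with h | h
  · have hn : ‖(θ * Complex.I : ℂ)‖ = |θ| := by simp
    have h1 := Complex.exp_bound (x := θ * Complex.I) (by rw [hn]; exact h) (n := 3) (by norm_num)
    have h2 : ∑ m ∈ Finset.range 3, (θ * Complex.I : ℂ) ^ m / (m.factorial : ℂ)
        = 1 + θ * Complex.I - (θ ^ 2 / 2 : ℝ) := by
      simp [Finset.sum_range_succ, mul_pow, Nat.factorial]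
      ring
    rw [h2, hn] at h1
    refine h1.trans ?_
    have h3 : |θ| ^ 3 ≤ |θ| ^ a := by
      rcases eq_or_lt_of_le (abs_nonneg θ) with h0 | h0
      · rw [← h0, Real.zero_rpow (by linarith)]
        norm_num
      · rw [← Real.rpow_natCast]
        exact Real.rpow_le_rpow_of_exponent_ge h0 h (by exact_mod_cast ha3)
    have h4 : 0 ≤ |θ| ^ a := by positivity
    norm_num [Nat.factorial]
    nlinarith
  · have h1 : θ ^ 2 ≤ |θ| ^ a := by
      rw [← sq_abs, ← Real.rpow_natCast]
      exact Real.rpow_le_rpow_of_exponent_le h (by exact_mod_cast ha)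
    have h2 : ‖Complex.exp (θ * Complex.I) - (1 + θ * Complex.I - (θ ^ 2 / 2 : ℝ))‖
        ≤ 1 + ((1 + |θ|) + θ ^ 2 / 2) := by
      refine (norm_sub_le _ _).trans (add_le_add (Complex.norm_exp_ofReal_mul_I θ).le ?_)
      refine (norm_sub_le _ _).trans (add_le_add ((norm_add_le _ _).trans (by simp)) ?_)
      rw [Complex.norm_real, Real.norm_of_nonneg (by positivity)]
    have h3 : 1 ≤ |θ| ^ 2 := one_le_pow₀ h
    have h4 : |θ| ≤ |θ| ^ 2 := by nlinarith
    rw [sq_abs] at h3 h4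
    linarith

/-- Because the moments of `f` up to order two vanish, its Fourier transform is `O(|ξ|^a)`. -/
theorem norm_transform_le (ha : 2 ≤ a) (ha3 : a < 3) {f : L1w a} (hf : f ∈ Y0 a) (ξ : ℝ) :
    ‖transform (zero_le_two.trans ha) ξ f‖ ≤ 4 * |ξ| ^ a * ‖f‖ := by
  set T : ℝ → ℂ := fun x => 1 + (ξ * x : ℝ) * Complex.I - ((ξ * x) ^ 2 / 2 : ℝ) with hT
  have hTi : ∀ x, f x • T x = (f x * x ^ 0) • (1 : ℂ) + (f x * x ^ 1) • (ξ * Complex.I)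
      - (f x * x ^ 2) • ((ξ ^ 2 / 2 : ℝ) : ℂ) := by
    intro x
    simp only [hT, Complex.real_smul]
    push_cast
    ring
  have hi : ∀ j < 3, ∀ c : ℂ, Integrable fun x => (f x * x ^ j) • c :=
    fun j hj c => (hf j hj).1.smul_const c
  have hi01 : Integrable fun x =>
      (f x * x ^ 0) • (1 : ℂ) + (f x * x ^ 1) • (ξ * Complex.I) :=
    (hi 0 (by norm_num) _).add (hi 1 (by norm_num) _)
  have hTint : Integrable fun x => f x • T x := by
    simp only [hTi]
    exact hi01.sub (hi 2 (by norm_num) _)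
  have hT0 : ∫ x, f x • T x = 0 := by
    simp only [hTi]
    rw [integral_sub hi01 (hi 2 (by norm_num) _),
      integral_add (hi 0 (by norm_num) _) (hi 1 (by norm_num) _), integral_smul_const,
      integral_smul_const, integral_smul_const, (hf 0 (by norm_num)).2, (hf 1 (by norm_num)).2,
      (hf 2 (by norm_num)).2]
    simp
  have h1 : transform (zero_le_two.trans ha) ξ f = ∫ x, f x • (character ξ x - T x) := by
    simp only [smul_sub]
    rw [integral_sub (integrable_smul_of_le_weight (integrable_coe f)
      (continuous_character ξ).stronglyMeasurable (character_le_weight (by linarith) ξ)) hTint,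
      hT0, transform_apply]
    exact (sub_zero _).symm
  rw [h1, norm_eq_integral_weight]
  refine norm_integral_smul_le (integrable_coe f) fun x => ?_
  refine (norm_exp_sub_taylor_le ha ha3.le (ξ * x)).trans ?_
  rw [abs_mul, Real.mul_rpow (abs_nonneg _) (abs_nonneg _), ← mul_assoc]
  gcongr
  exact abs_rpow_le_weight (by linarith) x

theorem transform_div_le (ha : 2 ≤ a) (ha3 : a < 3) (f : Y0 a) (ξ : ℝ) :
    ‖transform (zero_le_two.trans ha) ξ (f : L1w a)‖ / |ξ| ^ a ≤ 4 * ‖f‖ := by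
  refine div_le_of_le_mul₀ (by positivity) (by positivity) ?_
  have := norm_transform_le ha ha3 f.2 ξ
  rw [mul_right_comm]
  exact this

theorem bddAbove_transform_div (ha : 2 ≤ a) (ha3 : a < 3) (f : Y0 a) :
    BddAbove (Set.range fun ξ : ℝ => ‖transform (zero_le_two.trans ha) ξ (f : L1w a)‖ / |ξ| ^ a) :=
  ⟨4 * ‖f‖, Set.forall_mem_range.2 (transform_div_le ha ha3 f)⟩

/-- The Fourier seminorm `sup_ξ |f̂(ξ)| / |ξ|^a` on `Y0 a`. The junk value `0` of the quotient at
`ξ = 0` is harmless, as `f̂(0) = 0`. -/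
def fourierSeminorm (ha : 2 ≤ a) (ha3 : a < 3) : Seminorm ℝ (Y0 a) :=
  Seminorm.of (fun f => ⨆ ξ : ℝ, ‖transform (zero_le_two.trans ha) ξ (f : L1w a)‖ / |ξ| ^ a)
    (fun f g => ciSup_le fun ξ => by
      rw [Submodule.coe_add, _root_.map_add]
      refine le_trans ?_ (add_le_add (le_ciSup (bddAbove_transform_div ha ha3 f) ξ)
        (le_ciSup (bddAbove_transform_div ha ha3 g) ξ))
      rw [← add_div]
      gcongr
      exact norm_add_le _ _)
    (fun c f => by
      rw [Real.mul_iSup_of_nonneg (norm_nonneg c)]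
      congr 1
      ext ξ
      rw [Submodule.coe_smul, map_smul, norm_smul, mul_div_assoc])

theorem fourierSeminorm_le_norm (ha : 2 ≤ a) (ha3 : a < 3) (f : Y0 a) :
    fourierSeminorm ha ha3 f ≤ 4 * ‖f‖ :=
  ciSup_le (transform_div_le ha ha3 f)

theorem norm_transform_le_fourierSeminorm (ha : 2 ≤ a) (ha3 : a < 3) (f : Y0 a) (ξ : ℝ) :
    ‖transform (zero_le_two.trans ha) ξ (f : L1w a)‖ ≤ fourierSeminorm ha ha3 f * |ξ| ^ a := by
  rcases eq_or_ne ξ 0 with rfl | hξ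
  · have := norm_transform_le ha ha3 f.2 0
    rw [abs_zero, Real.zero_rpow (by linarith)] at this ⊢
    simpa using this
  · have hpos : 0 < |ξ| ^ a := Real.rpow_pos_of_pos (abs_pos.2 hξ) a
    rw [← div_le_iff₀ hpos]
    exact le_ciSup (bddAbove_transform_div ha ha3 f) ξ

theorem fourierSeminorm_le_of_forall (ha : 2 ≤ a) (ha3 : a < 3) {f : Y0 a} {M : ℝ} (hM : 0 ≤ M)
    (h : ∀ ξ, ‖transform (zero_le_two.trans ha) ξ (f : L1w a)‖ ≤ M * |ξ| ^ a) :
    fourierSeminorm ha ha3 f ≤ M :=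
  ciSup_le fun ξ => div_le_of_le_mul₀ (by positivity) hM (h ξ)

theorem transform_dilateOp (ha : 0 ≤ a) (t ξ : ℝ) (f : L1w a) :
    transform ha ξ (dilateOp ha t f) = transform ha (Real.exp (t / 4) * ξ) f := by
  rw [transform_apply, transform_apply]
  have h : ∫ x, dilateOp ha t f x • character ξ x = ∫ x, dilate t f x • character ξ x := by
    refine integral_congr_ae ?_
    filter_upwards [coeFn_dilateOp ha t f] with x hx
    rw [hx]
  rw [h, integral_dilate_smul]
  congr 1
  ext y
  simp only [character]
  congr 4
  ring

theorem fourierSeminorm_lossGroup_le (ha : 2 ≤ a) (ha3 : a < 3) (t : ℝ) (f : Y0 a) :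
    fourierSeminorm ha ha3 (lossGroup ha t f)
      ≤ Real.exp ((a / 4 - 1) * t) * fourierSeminorm ha ha3 f := by
  refine fourierSeminorm_le_of_forall ha ha3 (by positivity) fun ξ => ?_
  rw [coe_lossGroup, map_smul, transform_dilateOp, norm_smul,
    Real.norm_of_nonneg (Real.exp_pos _).le]
  have h := norm_transform_le_fourierSeminorm ha ha3 f (Real.exp (t / 4) * ξ)
  rw [abs_mul, abs_of_pos (Real.exp_pos _), Real.mul_rpow (Real.exp_pos _).le (abs_nonneg _),
    ← Real.exp_mul] at h
  have h2 : Real.exp ((a / 4 - 1) * t) = Real.exp (-t) * Real.exp (t / 4 * a) := by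
    rw [← Real.exp_add]; ring_nf
  rw [h2]
  calc Real.exp (-t) * _ ≤ Real.exp (-t) * _ := mul_le_mul_of_nonneg_left h (Real.exp_pos _).le
    _ = _ := by ring

/-- In Fourier variables the gain operator is `f̂(ξ) ↦ 2 f̂(ξ/2) Ĥ(ξ/2)`. -/
theorem transform_gainOp (ha : 0 ≤ a) (ha3 : a < 3) (ξ : ℝ) (f : L1w a) :
    transform ha ξ (gainOp ha ha3 f)
      = transform ha (ξ / 2) f * (2 * ∫ z, profile z • character (ξ / 2) z) := by
  rw [transform_apply, transform_apply]
  have h : ∫ x, gainOp ha ha3 f x • character ξ x = ∫ x, gain f x • character ξ x := by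
    refine integral_congr_ae ?_
    filter_upwards [coeFn_gainOp ha ha3 f] with x hx
    rw [hx]
  rw [h, integral_gain_smul ha ha3 (integrable_coe f) (continuous_character ξ).stronglyMeasurable
    (character_le_weight ha ξ), ← integral_mul_const]
  congr 1
  ext y
  have h1 : ∀ z, profile z • character ξ ((y + z) / 2)
      = character (ξ / 2) y * (profile z • character (ξ / 2) z) := by
    intro z
    rw [mul_smul_comm]
    congr 1
    unfold character
    rw [← Complex.exp_add]
    congr 1
    push_cast
    ring
  simp only [h1]
  rw [integral_const_mul, smul_mul_assoc]
  congr 1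
  rw [Complex.real_smul]
  push_cast
  ring

theorem norm_integral_profile_character_le (ξ : ℝ) : ‖∫ z, profile z • character ξ z‖ ≤ 1 := by
  refine (norm_integral_le_integral_norm _).trans (le_of_eq ?_)
  rw [← integral_profile]
  congr 1
  ext z
  rw [norm_smul, norm_character, mul_one, Real.norm_of_nonneg (profile_nonneg z)]

theorem fourierSeminorm_gainY0_le (ha : 2 ≤ a) (ha3 : a < 3) (f : Y0 a) :
    fourierSeminorm ha ha3 (gainY0 ha ha3 f) ≤ 2 ^ (1 - a) * fourierSeminorm ha ha3 f := by
  refine fourierSeminorm_le_of_forall ha ha3 (by positivity) fun ξ => ?_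
  change ‖transform _ ξ (gainOp (zero_le_two.trans ha) ha3 (f : L1w a))‖ ≤ _
  rw [transform_gainOp, norm_mul, norm_mul, Complex.norm_ofNat]
  have h := norm_transform_le_fourierSeminorm ha ha3 f (ξ / 2)
  rw [abs_div, abs_two, Real.div_rpow (abs_nonneg _) (by norm_num)] at h
  have h2 := norm_integral_profile_character_le (ξ / 2)
  calc _ ≤ fourierSeminorm ha ha3 f * (|ξ| ^ a / 2 ^ a) * (2 * 1) := by gcongr
    _ = _ := by
      rw [Real.rpow_sub (by norm_num), Real.rpow_one]
      ring

/-! ### The regularising effect of the gain operator -/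

theorem integrableOn_profile_transform (ha : 0 ≤ a) :
    IntegrableOn (fun ξ : ℝ => (1 + ξ) * Real.exp (-ξ) * ξ ^ a) (Set.Ioi 0) := by
  have h1 := Real.GammaIntegral_convergent (s := a + 1) (by linarith)
  have h2 := Real.GammaIntegral_convergent (s := a + 1 + 1) (by linarith)
  refine (h1.add h2).congr_fun (fun ξ hξ => ?_) measurableSet_Ioi
  simp only [Pi.add_apply, add_sub_cancel_right]
  rw [Real.rpow_add_one (ne_of_gt hξ)]
  ring

theorem tendsto_one_add_mul_exp_neg :
    Tendsto (fun ξ : ℝ => (1 + ξ) * Real.exp (-ξ)) atTop (𝓝 0) := by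
  have h1 := Real.tendsto_pow_mul_exp_neg_atTop_nhds_zero 0
  have h2 := Real.tendsto_pow_mul_exp_neg_atTop_nhds_zero 1
  have h3 := h1.add h2
  simp only [pow_zero, one_mul, pow_one, add_zero] at h3
  exact h3.congr fun ξ => by ring

theorem integrableOn_one_add_mul_exp_neg :
    IntegrableOn (fun ξ : ℝ => (1 + ξ) * Real.exp (-ξ)) (Set.Ioi 0) := by
  simpa using integrableOn_profile_transform (le_refl (0 : ℝ))

theorem integrableOn_smul_character (z : ℝ) :
    IntegrableOn (fun ξ : ℝ => ((1 + ξ) * Real.exp (-ξ)) • character ξ z) (Set.Ioi 0) := by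
  have hc : Continuous fun ξ : ℝ => (1 + ξ) * Real.exp (-ξ) := by fun_prop
  have hch : Continuous fun ξ : ℝ => character ξ z :=
    continuous_uncurry_character.comp (by fun_prop : Continuous fun ξ : ℝ => (ξ, z))
  refine Integrable.mono integrableOn_one_add_mul_exp_neg (hc.smul hch).aestronglyMeasurable
    (Eventually.of_forall fun ξ => ?_)
  rw [norm_smul, norm_character, mul_one]

theorem integral_smul_character (z : ℝ) :
    ∫ ξ in Set.Ioi (0 : ℝ), ((1 + ξ) * Real.exp (-ξ)) • character ξ z
      = (1 - z * Complex.I)⁻¹ + (1 - z * Complex.I)⁻¹ ^ 2 := by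
  set w : ℂ := 1 - z * Complex.I with hw
  have hre : w.re = 1 := by simp [hw]
  have hw0 : w ≠ 0 := fun h => by simp [h] at hre
  have hint : ∀ ξ : ℝ, ((1 + ξ) * Real.exp (-ξ)) • character ξ z
      = (1 + ξ) * Complex.exp (-w * ξ) := by
    intro ξ
    unfold character
    rw [Complex.real_smul, Complex.ofReal_mul, mul_assoc, Complex.ofReal_exp, ← Complex.exp_add]
    push_cast
    rw [hw]
    congr 2
    ring
  have hd : ∀ ξ ∈ Set.Ici (0 : ℝ), HasDerivAt
      (fun ξ : ℝ => -((1 + ξ) * w⁻¹ + w⁻¹ ^ 2) * Complex.exp (-w * ξ))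
      (((1 + ξ) * Real.exp (-ξ)) • character ξ z) ξ := by
    intro ξ _
    have h1 : HasDerivAt (fun ξ : ℝ => (ξ : ℂ)) 1 ξ := Complex.ofRealCLM.hasDerivAt
    have h2 : HasDerivAt (fun ξ : ℝ => Complex.exp (-w * ξ)) (Complex.exp (-w * ξ) * (-w * 1)) ξ :=
      (h1.const_mul (-w)).cexp
    have h3 : HasDerivAt (fun ξ : ℝ => -((1 + (ξ : ℂ)) * w⁻¹ + w⁻¹ ^ 2)) (-(1 * w⁻¹)) ξ :=
      (((h1.const_add 1).mul_const w⁻¹).add_const _).neg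
    refine (h3.mul h2).congr_deriv ?_
    rw [hint]
    field_simp
    ring
  have hlim : Tendsto (fun ξ : ℝ => -((1 + ξ) * w⁻¹ + w⁻¹ ^ 2) * Complex.exp (-w * ξ)) atTop
      (𝓝 0) := by
    have h1 := (tendsto_one_add_mul_exp_neg.mul_const ‖w⁻¹‖).add
      (Real.tendsto_exp_neg_atTop_nhds_zero.mul_const (‖w⁻¹‖ ^ 2))
    simp only [zero_mul, add_zero] at h1
    refine squeeze_zero_norm' ?_ h1
    filter_upwards [eventually_ge_atTop 0] with ξ hξ
    have h2 : ‖Complex.exp (-w * ξ)‖ = Real.exp (-ξ) := by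
      rw [Complex.norm_exp]
      congr 1
      simp [hre]
    have h3 : ‖(1 + ξ : ℂ)‖ = 1 + ξ := by
      rw [← Complex.ofReal_one, ← Complex.ofReal_add, Complex.norm_real,
        Real.norm_of_nonneg (by linarith)]
    rw [norm_mul, norm_neg, h2]
    calc _ ≤ ((1 + ξ) * ‖w⁻¹‖ + ‖w⁻¹‖ ^ 2) * Real.exp (-ξ) := by
          gcongr
          refine (norm_add_le _ _).trans (le_of_eq ?_)
          rw [norm_mul, norm_pow, h3]
      _ = _ := by ring
  rw [integral_Ioi_of_hasDerivAt_of_tendsto' hd (integrableOn_smul_character z) hlim]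
  simp

/-- Fourier inversion for the profile, whose transform is `(1 + |ξ|) e^{-|ξ|}`. Since the profile is
even, the real part of the integral over `ξ > 0` suffices. -/
theorem profile_eq_re_integral (z : ℝ) :
    profile z = Real.pi⁻¹ *
      (∫ ξ in Set.Ioi (0 : ℝ), ((1 + ξ) * Real.exp (-ξ)) • character ξ z).re := by
  rw [integral_smul_character]
  have h0 : 1 + z ^ 2 ≠ 0 := by positivity
  have hinv : (1 - z * Complex.I : ℂ)⁻¹ = ((1 + z ^ 2)⁻¹ : ℝ) * (1 + z * Complex.I) := by
    refine inv_eq_of_mul_eq_one_right ?_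
    have h1 : (1 - z * Complex.I : ℂ) * (1 + z * Complex.I) = ((1 + z ^ 2 : ℝ) : ℂ) := by
      push_cast
      ring_nf
      rw [Complex.I_sq]
      ring
    rw [mul_left_comm, h1, ← Complex.ofReal_mul, inv_mul_cancel₀ h0, Complex.ofReal_one]
  rw [hinv, mul_pow]
  have h2 : (1 + z * Complex.I : ℂ) ^ 2
      = ((1 - z ^ 2 : ℝ) : ℂ) + ((2 * z : ℝ) : ℂ) * Complex.I := by
    push_cast
    ring_nf
    rw [Complex.I_sq]
    ring
  rw [h2, ← Complex.ofReal_pow]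
  simp only [Complex.add_re, Complex.one_re, Complex.mul_re,
    Complex.ofReal_re, Complex.ofReal_im, Complex.I_re, Complex.I_im]
  unfold profile
  have := Real.pi_ne_zero
  field_simp
  ring

/-- The gain term is bounded pointwise by the Fourier seminorm. -/
theorem abs_gain_le_fourierSeminorm (ha : 2 ≤ a) (ha3 : a < 3) (f : Y0 a) (x : ℝ) :
    |gain (f : L1w a) x| ≤ (4 * Real.pi⁻¹ *
      ∫ ξ in Set.Ioi (0 : ℝ), (1 + ξ) * Real.exp (-ξ) * ξ ^ a) * fourierSeminorm ha ha3 f := by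
  have ha0 : 0 ≤ a := by linarith
  set G : ℝ → ℝ := fun ξ => (1 + ξ) * Real.exp (-ξ) with hG
  have hfi := integrable_coe_volume ha0 (f : L1w a)
  have hprod : Integrable (fun p : ℝ × ℝ => (f : L1w a) p.1 • G p.2 • character p.2 (p.1 - 2 * x))
      (volume.prod (volume.restrict (Set.Ioi 0))) := by
    have hc : Continuous fun p : ℝ × ℝ => G p.2 := by simp only [hG]; fun_prop
    have hch : Continuous fun p : ℝ × ℝ => character p.2 (p.1 - 2 * x) :=
      continuous_uncurry_character.comp
        (by fun_prop : Continuous fun p : ℝ × ℝ => (p.2, p.1 - 2 * x))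
    refine (hfi.mul_prod integrableOn_one_add_mul_exp_neg).mono
      ((hfi.aestronglyMeasurable.comp_fst).smul (hc.smul hch).aestronglyMeasurable)
      (Eventually.of_forall fun p => ?_)
    rw [norm_smul, norm_smul, norm_character, mul_one, ← norm_mul]
  have h1 : ∀ y, (f : L1w a) y * profile (2 * x - y) = Real.pi⁻¹ *
      (∫ ξ in Set.Ioi (0 : ℝ), (f : L1w a) y • G ξ • character ξ (y - 2 * x)).re := by
    intro y
    rw [← profile_neg, neg_sub, profile_eq_re_integral, integral_smul, Complex.smul_re, smul_eq_mul]
    ring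
  have h2 : ∫ y, (f : L1w a) y * profile (2 * x - y) = Real.pi⁻¹ *
      (∫ y, ∫ ξ in Set.Ioi (0 : ℝ), (f : L1w a) y • G ξ • character ξ (y - 2 * x)).re := by
    simp only [h1]
    rw [integral_const_mul]
    congr 1
    exact (Complex.reCLM.integral_comp_comm hprod.integral_prod_left)
  have h3 : ∀ ξ, ∫ y, (f : L1w a) y • G ξ • character ξ (y - 2 * x)
      = (G ξ • character ξ (-(2 * x))) * transform ha0 ξ (f : L1w a) := by
    intro ξ
    rw [transform_apply, ← integral_const_mul]
    congr 1
    ext y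
    have : character ξ (y - 2 * x) = character ξ (-(2 * x)) * character ξ y := by
      unfold character
      rw [← Complex.exp_add]
      congr 1
      push_cast
      ring
    rw [this]
    simp only [Complex.real_smul]
    ring
  have h4 : ‖∫ ξ in Set.Ioi (0 : ℝ), ∫ y, (f : L1w a) y • G ξ • character ξ (y - 2 * x)‖
      ≤ ∫ ξ in Set.Ioi (0 : ℝ), (1 + ξ) * Real.exp (-ξ) * ξ ^ a * fourierSeminorm ha ha3 f := by
    refine norm_integral_le_of_norm_le ((integrableOn_profile_transform ha0).mul_const _) ?_
    filter_upwards [ae_restrict_mem measurableSet_Ioi] with ξ hξ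
    have hξ0 : 0 < ξ := hξ
    rw [h3, norm_mul, norm_smul, norm_character, mul_one,
      Real.norm_of_nonneg (show 0 ≤ G ξ by simp only [hG]; positivity)]
    have h5 := norm_transform_le_fourierSeminorm ha ha3 f ξ
    rw [abs_of_pos hξ0] at h5
    calc G ξ * _ ≤ G ξ * _ := mul_le_mul_of_nonneg_left h5 (by simp only [hG]; positivity)
      _ = _ := by simp only [hG]; ring
  rw [integral_mul_const] at h4
  rw [gain, h2, abs_mul, abs_mul, abs_of_pos (by norm_num : (0 : ℝ) < 4),
    abs_of_pos (inv_pos.2 Real.pi_pos), integral_integral_swap hprod, ← mul_assoc]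
  rw [mul_assoc (4 * Real.pi⁻¹) (∫ ξ in Set.Ioi (0 : ℝ), _)]
  refine mul_le_mul_of_nonneg_left ?_ (by positivity)
  exact (Complex.abs_re_le_norm _).trans h4

/-- Up to a multiple of the Fourier seminorm, the gain operator has the norm `2^{1-a}`: near the
origin it is regularising, and far from the origin it contracts the weight. -/
theorem exists_norm_gainY0_le (ha : 2 ≤ a) (ha3 : a < 3) {ε : ℝ} (hε : 0 < ε) :
    ∃ C, 0 ≤ C ∧ ∀ f : Y0 a, ‖gainY0 ha ha3 f‖
      ≤ (2 ^ (1 - a) + ε) * ‖f‖ + C * fourierSeminorm ha ha3 f := by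
  have ha0 : 0 ≤ a := by linarith
  obtain ⟨R, -, hR⟩ := exists_gain_tail_le ha0 ha3 hε
  set c := 4 * Real.pi⁻¹ * ∫ ξ in Set.Ioi (0 : ℝ), (1 + ξ) * Real.exp (-ξ) * ξ ^ a with hc
  have hc0 : 0 ≤ c := by
    refine mul_nonneg (by positivity) (setIntegral_nonneg measurableSet_Ioi fun ξ hξ => ?_)
    have : (0 : ℝ) < ξ := hξ
    positivity
  set A : Set ℝ := {x | R < |x|} with hA
  have hAm : MeasurableSet A := measurableSet_lt measurable_const (by fun_prop)
  have hAc : Aᶜ = Metric.closedBall (0 : ℝ) R := by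
    ext x
    simp [hA]
  have hw : IntegrableOn (weight a) Aᶜ := by
    rw [hAc]
    exact (continuous_weight a).continuousOn.integrableOn_compact (isCompact_closedBall _ _)
  refine ⟨c * ∫ x in Aᶜ, weight a x, mul_nonneg hc0 (setIntegral_nonneg hAm.compl fun x _ =>
    (weight_pos a x).le), fun f => ?_⟩
  have hgi := integrable_weight_mul_abs (integrable_gain ha0 ha3 (integrable_coe (f : L1w a)))
  have h1 : ‖gainY0 ha ha3 f‖ = ∫ x, weight a x * |gain (f : L1w a) x| := by
    change ‖gainOp ha0 ha3 (f : L1w a)‖ = _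
    rw [norm_eq_integral_weight]
    refine integral_congr_ae ?_
    filter_upwards [coeFn_gainOp ha0 ha3 (f : L1w a)] with x hx
    rw [hx]
  rw [h1, ← integral_add_compl hAm hgi]
  refine add_le_add ?_ ?_
  · have h2 := integral_indicator_gain_le ha0 ha3 (integrable_coe (f : L1w a)) hAm hR
    rwa [← norm_eq_integral_weight] at h2
  · calc ∫ x in Aᶜ, weight a x * |gain (f : L1w a) x|
        ≤ ∫ x in Aᶜ, weight a x * (c * fourierSeminorm ha ha3 f) := by
          refine integral_mono hgi.integrableOn (hw.mul_const _) fun x => ?_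
          exact mul_le_mul_of_nonneg_left (abs_gain_le_fourierSeminorm ha ha3 f x)
            (weight_pos a x).le
      _ = _ := by rw [integral_mul_const]; ring

/-! ### Exponential stability -/

/-- In the seminorm `‖f‖ + M sup_ξ |f̂(ξ)| / |ξ|^a`, for large `M`, the perturbed semigroup grows at
most at the rate `a / 4 - 1 + 2^{1-a} + ε`. -/
theorem exists_norm_semigroup_le (ha : 2 ≤ a) (ha3 : a < 3) {S : ℝ≥0 → Y0 a →L[ℝ] Y0 a}
    (hSg : IsStronglyContinuousSemigroup S)
    (hS : ∀ f, Tendsto (fun t : ℝ≥0 => (t : ℝ)⁻¹ • (S t f - lossGroup ha t f)) (𝓝[≠] 0)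
      (𝓝 (gainY0 ha ha3 f))) {ν : ℝ} (hν : ν < 1 - a / 4 - 2 ^ (1 - a)) :
    ∃ C, 0 < C ∧ ∀ (f : Y0 a) (t : ℝ≥0), ‖S t f‖ ≤ C * Real.exp (-ν * t) * ‖f‖ := by
  set ε := 1 - a / 4 - 2 ^ (1 - a) - ν with hε
  have hε0 : 0 < ε := by linarith
  obtain ⟨B, hB, hgain⟩ := exists_norm_gainY0_le ha ha3 hε0
  set F := fourierSeminorm ha ha3 with hF
  set M : ℝ≥0 := ⟨B / ε, by positivity⟩ with hM
  have hMv : (M : ℝ) * ε = B := div_mul_cancel₀ _ hε0.ne'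
  set N : Seminorm ℝ (Y0 a) := normSeminorm ℝ (Y0 a) + M • F with hN
  have hNv : ∀ f, N f = ‖f‖ + M * F f := fun f => rfl
  have hNle : ∀ f, N f ≤ (1 + M * 4) * ‖f‖ := by
    intro f
    rw [hNv]
    have := mul_le_mul_of_nonneg_left (fourierSeminorm_le_norm ha ha3 f) M.coe_nonneg
    linarith
  have hleN : ∀ f, ‖f‖ ≤ N f := by
    intro f
    rw [hNv]
    have := mul_nonneg M.coe_nonneg (apply_nonneg F f)
    linarith
  have hNc : Continuous N := by
    refine Seminorm.continuous_of_le (q := (1 + M * 4) • normSeminorm ℝ (Y0 a)) ?_ fun f => hNle f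
    exact continuous_norm.const_smul (1 + M * 4)
  have hNT : ∀ t, 0 ≤ t → ∀ f, N (lossGroup ha t f) ≤ Real.exp ((a / 4 - 1) * t) * N f := by
    intro t ht f
    rw [hNv, hNv, mul_add]
    refine add_le_add (norm_lossGroup_le ha ht f) ?_
    rw [mul_left_comm]
    exact mul_le_mul_of_nonneg_left (fourierSeminorm_lossGroup_le ha ha3 t f) M.coe_nonneg
  have hNK : ∀ f, N (gainY0 ha ha3 f) ≤ (2 ^ (1 - a) + ε) * N f := by
    intro f
    rw [hNv, hNv]
    have h1 := hgain f
    have h2 := mul_le_mul_of_nonneg_left (fourierSeminorm_gainY0_le ha ha3 f) M.coe_nonneg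
    rw [← hMv] at h1
    linarith
  refine ⟨1 + M * 4, by positivity, fun f t => ?_⟩
  have h := hSg.seminorm_le hS N hNc hNT hNK t f
  have hrate : a / 4 - 1 + (2 ^ (1 - a) + ε) = -ν := by rw [hε]; ring
  rw [hrate] at h
  calc ‖S t f‖ ≤ Real.exp (-ν * t) * N f := (hleN _).trans h
    _ ≤ Real.exp (-ν * t) * ((1 + M * 4) * ‖f‖) := by gcongr; exact hNle f
    _ = _ := by ring

end

end

end Maxwell

theorem theorem1p5 (a : ℝ) (ha2 : 2 < a) (ha3 : a < 3) :
    ∃ S : ℝ≥0 → Maxwell.Y0 a →L[ℝ] Maxwell.Y0 a,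
      Maxwell.IsStronglyContinuousSemigroup S ∧
      (∀ k : ℝ, 2 < k → k ≤ a →
        Maxwell.IsGenerator S fun f g =>
          Maxwell.LinOp k (Maxwell.toMeasure (f : Maxwell.L1w a))
            (Maxwell.toMeasure (g : Maxwell.L1w a))) ∧
      ∀ ν : ℝ, 0 < ν → ν < 1 - a / 4 - (2 : ℝ) ^ (1 - a) →
        ∃ C : ℝ, 0 < C ∧
          (∀ (h : Maxwell.Y0 a) (t : ℝ≥0), ‖S t h‖ ≤ C * Real.exp (-ν * t) * ‖h‖) ∧
          (∀ k : ℝ, 2 < k → k ≤ a → ∀ (h : Maxwell.Y0 a) (g : Maxwell.L1w a),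
            Maxwell.LinOp k (Maxwell.toMeasure (h : Maxwell.L1w a)) (Maxwell.toMeasure g) →
              ν / C * ‖h‖ ≤ ‖g‖) := by
  have := Maxwell.completeSpace_Y0 ha2.le
  obtain ⟨S, hSg, hS⟩ := Maxwell.exists_semigroup_of_perturbation
    (Maxwell.isGroupWithBound_lossGroup ha2.le ha3) zero_le_one (Maxwell.gainY0 ha2.le ha3)
  have hgen : ∀ k : ℝ, 2 < k → k ≤ a → Maxwell.IsGenerator S fun f g =>
      Maxwell.LinOp k (Maxwell.toMeasure (f : Maxwell.L1w a))
        (Maxwell.toMeasure (g : Maxwell.L1w a)) := by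
    intro k _ hk f g
    exact Maxwell.linOp_iff_tendsto hk ha2.le ha3 hS f g
  refine ⟨S, hSg, hgen, fun ν hν0 hν => ?_⟩
  obtain ⟨C, hC, hSC⟩ := Maxwell.exists_norm_semigroup_le ha2.le ha3 hSg hS hν
  refine ⟨C, hC, hSC, fun k _ hk h g hg => ?_⟩
  -- The range of the linearised operator consists of densities with vanishing moments, so that
  -- `g` belongs to the space on which the semigroup acts.
  have hgY := ((Maxwell.linOp_toMeasure_iff hk ha2.le ha3 h.2 g).1 hg).1
  have hlim := (Maxwell.linOp_iff_tendsto hk ha2.le ha3 hS h ⟨g, hgY⟩).1 hg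
  have hle := Maxwell.IsStronglyContinuousSemigroup.le_norm_generator hSg hC hν0
    (fun t f => hSC f t) hlim
  exact hle
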